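/- Let $G$ be a finite non-empty simple graph with $v(G)$ vertices, let $m_k(G)$ be the number of its matchings with exactly $k$ edges, $\nu(G)$ the number of edges of a largest matching, $M(G,t)=\sum_{k\ge 0} m_k(G)t^k$, and for $t\ge 0$ let $$p(G,t)=\frac{2\,t\,M'(G,t)}{v(G)\,M(G,t)},\qquad F(G,t)=\frac{\ln M(G,t)}{v(G)}-\frac12\,p(G,t)\ln t .$$ Put $p^*=2\nu(G)/v(G)$. If $G$ has an edge, $t\mapsto p(G,t)$ is a strictly increasing bijection from $[0,\infty)$ onto $[0,p^*)$, with inverse $t(p)$. The entropy function of $G$ is $\lambda_G(p)=F(G,t(p))$ for $0\le p<p^*$, $\lambda_G(p^*)=\lim_{p\nearrow p^*}\lambda_G(p)$, and $\lambda_G(p)=0$ for $p>p^*$. For an integer $d\ge 2$ and $p\in[0,1]$ let $$\mathbb{G}_d(p)=\frac12\left(p\ln\frac dp+(d-p)\ln\left(1-\frac pd\right)-2(1-p)\ln(1-p)\right),$$ $$f(x)=\frac{1}{4d}\min\left(x,(1-x)^2\right)$$ (in $F$ and $\mathbb{G}_d$, the terms $0\ln 0$ and $0\ln(d/0)$ are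 read as $0$). Theorem. Let $d\ge 2$. (1) Let $G$ be a finite (non-empty, simple) $d$-regular vertex-transitive bipartite graph, and let $g(p)=\lambda_G(p)-\mathbb{G}_d(p)$ for $p\in[0,1]$. Then $g$ is monotone increasing on $[0,1]$ and $g(0)=0$; in particular $g(p)\ge 0$, that is, $\lambda_G(p)\ge\mathbb{G}_d(p)$, for all $p\in[0,1]$. If moreover $G$ contains a cycle of length $\ell$, then for all $p\in[0,1]$ $$g(p)\ \ge\ \int_0^p f(x)^{\ell}\,dx .$$ (2) For every positive integer $k$ there is a constant $c(k)>0$, which depends only on $k$ and $d$, such that every $d$-regular vertex-transitive bipartite graph on $2n\ge 2$ vertices that contains a cycle of length at most $k$ has at least $$\left(\frac{(d-1)^{d-1}}{d^{d-2}}+c(k)\right)^{n}$$ perfect matchings. -/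

import Mathlib

universe u

open Filter Topology

namespace MatchingEntropy

variable {V : Type u}

/-- A finite set of pairwise vertex-disjoint edges of `G`. -/
def IsEdgeMatching (G : SimpleGraph V) (S : Finset (Sym2 V)) : Prop :=
  (∀ e ∈ S, e ∈ G.edgeSet) ∧ ∀ e ∈ S, ∀ f ∈ S, e ≠ f → ∀ v, v ∈ e → v ∉ f

/-- `m_k(G)`, the number of matchings of `G` with exactly `k` edges. -/
noncomputable def numMatchings (G : SimpleGraph V) (k : ℕ) : ℕ :=
  Set.ncard {S : Finset (Sym2 V) | IsEdgeMatching G S ∧ S.card = k}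

/-- The number of perfect matchings of `G`, the matchings that cover every vertex. -/
noncomputable def numPerfectMatchings (G : SimpleGraph V) : ℕ :=
  Set.ncard {S : Finset (Sym2 V) | IsEdgeMatching G S ∧ ∀ v : V, ∃ e ∈ S, v ∈ e}

/-- `ν(G)`, the number of edges in a largest matching of the finite graph `G`. -/
noncomputable def matchingNumber (G : SimpleGraph V) : ℕ :=
  sSup {k : ℕ | ∃ S : Finset (Sym2 V), IsEdgeMatching G S ∧ S.card = k}

/-- Every vertex can be moved to every other one by an automorphism of `G`. -/
def IsVertexTransitive (G : SimpleGraph V) : Prop :=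
  ∀ u v : V, ∃ φ : G ≃g G, φ u = v

/-- `G` contains a cycle of length `l`. -/
def HasCycleOfLength (G : SimpleGraph V) (l : ℕ) : Prop :=
  ∃ (v : V) (c : G.Walk v v), c.IsCycle ∧ c.length = l

section Finite

variable [Fintype V]

/-- The matching generating polynomial `M(G, t) = ∑ k, m_k(G) t ^ k`. -/
noncomputable def matchingGenPoly (G : SimpleGraph V) : Polynomial ℝ :=
  ∑ k ∈ Finset.range (Fintype.card V / 2 + 1),
    Polynomial.C (numMatchings G k : ℝ) * Polynomial.X ^ k

/-- The density `p(G, t) = t M'(G, t) / (n M(G, t))`, where `n = v(G) / 2`. -/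
noncomputable def density (G : SimpleGraph V) (t : ℝ) : ℝ :=
  t * (matchingGenPoly G).derivative.eval t /
    ((Fintype.card V : ℝ) / 2 * (matchingGenPoly G).eval t)

/-- `F(G, t) = ln M(G, t) / v(G) - (1/2) p(G, t) ln t` (with `0 ln 0 = 0` at `t = 0`). -/
noncomputable def freeEntropy (G : SimpleGraph V) (t : ℝ) : ℝ :=
  Real.log ((matchingGenPoly G).eval t) / (Fintype.card V : ℝ)
    - 1 / 2 * density G t * Real.log t

/-- `p*(G) = 2 ν(G) / v(G)`, the fraction of vertices covered by a largest matching. -/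
noncomputable def maxDensity (G : SimpleGraph V) : ℝ :=
  2 * (matchingNumber G : ℝ) / (Fintype.card V : ℝ)

/-- `t(G, p)`, the inverse on `[0, p*(G))` of `t ↦ p(G, t)`, `t ∈ [0, ∞)`. -/
noncomputable def activity (G : SimpleGraph V) (p : ℝ) : ℝ :=
  Function.invFunOn (density G) (Set.Ici 0) p

/-- The entropy function: `λ_G(p) = F(G, t(G, p))` for `p < p*`, the left limit of this
function at `p = p*`, and `0` for `p > p*`. Only arguments `p ≥ 0` are meaningful. -/
noncomputable def matchingEntropy (G : SimpleGraph V) (p : ℝ) : ℝ :=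
  if p < maxDensity G then freeEntropy G (activity G p)
  else if p = maxDensity G then
    limUnder (𝓝[<] maxDensity G) (fun q => freeEntropy G (activity G q))
  else 0

end Finite

/-- Gurvits's function
`G_d(p) = (1/2) (p ln (d / p) + (d - p) ln (1 - p / d) - 2 (1 - p) ln (1 - p))`, with the
convention that `p ln (d / p)` is `0` at `p = 0` and `(1 - p) ln (1 - p)` is `0` at `p = 1`. -/
noncomputable def gurvitsFun (d : ℕ) (p : ℝ) : ℝ :=
  1 / 2 * (p * Real.log ((d : ℝ) / p) + ((d : ℝ) - p) * Real.log (1 - p / (d : ℝ))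
    - 2 * (1 - p) * Real.log (1 - p))

/-- The gap function `g(p) = λ_G(p) - G_d(p)`. -/
noncomputable def gap [Fintype V] (G : SimpleGraph V) (d : ℕ) (p : ℝ) : ℝ :=
  matchingEntropy G p - gurvitsFun d p

/-- `f(x) = min (x, (1 - x) ^ 2) / (4 d)`. -/
noncomputable def cycleWeight (d : ℕ) (x : ℝ) : ℝ :=
  1 / (4 * (d : ℝ)) * min x ((1 - x) ^ 2)

end MatchingEntropy

/-!
The entropy gap is controlled through its derivative. If `t(p)` denotes the activity at which `G`
has density `p`, then `λ_G'(p) = -(1/2) log t(p)`, and Gurvits's function satisfies the same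
relation with the activity `p (1 - p / d) / (d (1 - p) ^ 2)` of the infinite `d`-regular tree. So
everything follows from a lower bound for the ratio of the tree activity to `t(p)`.

That bound is a correlation inequality. Write `M(H)` for the matching generating function of `H`
at `t`. For `u`, `v` in opposite classes of a bipartite graph `H`, the difference
`M(H) M(H - u - v) - M(H - u) M(H - v)` is a sum of nonnegative contributions of the paths from `u`
to `v`. This is `signedCorrelation_eq`, a recursion obtained by expanding at `u`; a path `P`
contributes `t ^ |P| M(H - P) ^ 2`. In a vertex-transitive graph `M(G - u) / M(G) = 1 - p` for
every vertex `u`. Keeping only the path that consists of the edge `uv` gives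
`x - x ^ 2 ≥ t (1 - p) ^ 2` for the probability `x` of each edge. Summing over the `d` edges at a
vertex, whose probabilities add up to `p`, and using Cauchy–Schwarz yields
`d t (1 - p) ^ 2 ≤ p (1 - p / d)` (`density_ge_tree`): the activity of `G` is at most that of the
tree. A cycle of length `l` supplies one more path, of length `l - 1`, and with it an additional
term (`density_ge_of_cycle`) that is bounded from below by means of `M(H) ≤ (1 + d t) M(H - w)`;
`cycleWeight_le_of_activity` rewrites the bound in terms of `p` alone.

The same inequality shows that `p → 1` as `t → ∞`. Hence `G` has a perfect matching, `p* = 1`, and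
`λ_G(1)` is the logarithm of the number of perfect matchings divided by the number of vertices
(`matchingEntropy_one`), so that the lower bound for the gap at `1` counts perfect matchings.
-/

namespace MatchingEntropy

variable {V : Type u}

/-! ### Matchings of vertex-deleted subgraphs -/

section Combinatorics

open scoped Classical in
/-- The matchings of `G` that cover no vertex of `A`, that is, the matchings of `G - A`. -/
noncomputable def matchingsAvoiding [Fintype V] (G : SimpleGraph V) (A : Finset V) :
    Finset (Finset (Sym2 V)) :=
  {S | IsEdgeMatching G S ∧ ∀ e ∈ S, ∀ v ∈ e, v ∉ A}

/-- The matching generating function of `G - A` at `t`. Deleted vertices are recorded by the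
set `A`, so that all the vertex-deleted subgraphs live on the same vertex type. -/
noncomputable def deletedSum [Fintype V] (G : SimpleGraph V) (A : Finset V) (t : ℝ) : ℝ :=
  ∑ S ∈ matchingsAvoiding G A, t ^ S.card

variable [Fintype V] {G : SimpleGraph V} {A : Finset V} {S : Finset (Sym2 V)} {t : ℝ}

theorem mem_matchingsAvoiding :
    S ∈ matchingsAvoiding G A ↔ IsEdgeMatching G S ∧ ∀ e ∈ S, ∀ v ∈ e, v ∉ A := by
  simp [matchingsAvoiding]

theorem empty_mem_matchingsAvoiding : ∅ ∈ matchingsAvoiding G A := by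
  simp [mem_matchingsAvoiding, IsEdgeMatching]

theorem deletedSum_pos (ht : 0 ≤ t) : 0 < deletedSum G A t :=
  Finset.sum_pos' (fun _ _ => by positivity) ⟨∅, empty_mem_matchingsAvoiding, by simp⟩

open scoped Classical in
theorem deletedSum_insert_eq_sum_filter (w : V) :
    deletedSum G (insert w A) t =
      ∑ S ∈ matchingsAvoiding G A with (∀ e ∈ S, w ∉ e), t ^ S.card := by
  unfold deletedSum
  congr 1
  ext S
  simp only [mem_matchingsAvoiding, Finset.mem_filter, Finset.mem_insert, not_or]
  constructor
  · rintro ⟨h, h'⟩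
    exact ⟨⟨h, fun e he v hv => (h' e he v hv).2⟩, fun e he hw => (h' e he w hw).1 rfl⟩
  · rintro ⟨⟨h, h'⟩, h''⟩
    exact ⟨h, fun e he v hv => ⟨fun hvw => h'' e he (hvw ▸ hv), h' e he v hv⟩⟩

open scoped Classical in
/-- Removing the edge `ww'` is a bijection from the matchings of `G - A` through `ww'` to the
matchings of `G - A - w - w'`. -/
theorem sum_matchingsAvoiding_with_edge {w w' : V} (hadj : G.Adj w w') (hw : w ∉ A)
    (hw' : w' ∉ A) :
    ∑ S ∈ matchingsAvoiding G A with s(w, w') ∈ S, t ^ S.card =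
      t * deletedSum G (insert w' (insert w A)) t := by
  unfold deletedSum
  rw [Finset.mul_sum]
  have key : ∀ S ∈ matchingsAvoiding G (insert w' (insert w A)), s(w, w') ∉ S := fun S hS he =>
    (mem_matchingsAvoiding.1 hS).2 _ he w (by simp) (by simp)
  refine Finset.sum_bij' (fun S _ => S.erase s(w, w')) (fun S _ => insert s(w, w') S)
    ?_ ?_ ?_ ?_ ?_
  · intro S hS
    obtain ⟨hS, he⟩ := Finset.mem_filter.1 hS
    obtain ⟨⟨h1, h2⟩, h3⟩ := mem_matchingsAvoiding.1 hS
    refine mem_matchingsAvoiding.2 ⟨⟨fun e he => h1 e (Finset.mem_of_mem_erase he),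
      fun e he f hf => h2 e (Finset.mem_of_mem_erase he) f (Finset.mem_of_mem_erase hf)⟩, ?_⟩
    intro f hf v hv
    obtain ⟨hne, hf⟩ := Finset.mem_erase.1 hf
    have := h2 f hf _ he hne v hv
    simp only [Sym2.mem_iff, not_or] at this
    simp only [Finset.mem_insert, not_or]
    exact ⟨this.2, this.1, h3 f hf v hv⟩
  · intro S hS
    obtain ⟨⟨h1, h2⟩, h3⟩ := mem_matchingsAvoiding.1 hS
    have h4 : ∀ f ∈ S, ∀ v ∈ f, v ∉ s(w, w') := by
      intro f hf v hv hv'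
      have := h3 f hf v hv
      simp only [Finset.mem_insert, not_or] at this
      rcases Sym2.mem_iff.1 hv' with h | h
      exacts [this.2.1 h, this.1 h]
    refine Finset.mem_filter.2 ⟨mem_matchingsAvoiding.2 ⟨⟨?_, ?_⟩, ?_⟩,
      Finset.mem_insert_self _ _⟩
    · intro e he
      rcases Finset.mem_insert.1 he with rfl | he
      exacts [hadj, h1 e he]
    · intro e he f hf hne v hve hvf
      rcases Finset.mem_insert.1 he with rfl | he <;> rcases Finset.mem_insert.1 hf with rfl | hf
      · exact hne rfl
      · exact h4 f hf v hvf hve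
      · exact h4 e he v hve hvf
      · exact h2 e he f hf hne v hve hvf
    · intro e he v hv
      rcases Finset.mem_insert.1 he with rfl | he
      · rcases Sym2.mem_iff.1 hv with rfl | rfl
        exacts [hw, hw']
      · have := h3 e he v hv
        simp only [Finset.mem_insert, not_or] at this
        exact this.2.2
  · intro S hS
    exact Finset.insert_erase (Finset.mem_filter.1 hS).2
  · intro S hS
    exact Finset.erase_insert (key S hS)
  · intro S hS
    have he := (Finset.mem_filter.1 hS).2
    rw [← Finset.card_erase_add_one he, pow_succ, mul_comm]

open scoped Classical in
/-- A matching contains at most one edge at `w`. -/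
theorem sum_edges_at_eq_ite (hS : S ∈ matchingsAvoiding G A) (w : V) :
    ∑ w' with G.Adj w w' ∧ w' ∉ A, (if s(w, w') ∈ S then (1 : ℝ) else 0) =
      if ∀ e ∈ S, w ∉ e then 0 else 1 := by
  obtain ⟨⟨h1, h2⟩, h3⟩ := mem_matchingsAvoiding.1 hS
  split_ifs with h
  · refine Finset.sum_eq_zero fun w' _ => if_neg fun he => h _ he (by simp)
  · push Not at h
    obtain ⟨e, he, hwe⟩ := h
    obtain ⟨w', rfl⟩ := Sym2.mem_iff_exists.1 hwe
    rw [Finset.sum_eq_single w', if_pos he]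
    · intro x _ hx
      exact if_neg fun hx' => h2 _ hx' _ he (mt Sym2.congr_right.1 hx) w (by simp) (by simp)
    · intro hw'
      exact absurd (by simpa using ⟨h1 _ he, h3 _ he w' (by simp)⟩) hw'

open scoped Classical in
/-- Conditioning on the edge that covers `w`. -/
theorem deletedSum_eq_add_sum {w : V} (hw : w ∉ A) :
    deletedSum G A t = deletedSum G (insert w A) t +
      t * ∑ w' with G.Adj w w' ∧ w' ∉ A, deletedSum G (insert w' (insert w A)) t := by
  have h1 : ∀ w' ∈ ({w' | G.Adj w w' ∧ w' ∉ A} : Finset V),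
      t * deletedSum G (insert w' (insert w A)) t =
        ∑ S ∈ matchingsAvoiding G A, (if s(w, w') ∈ S then (1 : ℝ) else 0) * t ^ S.card := by
    intro w' hw'
    simp only [Finset.mem_filter, Finset.mem_univ, true_and] at hw'
    rw [← sum_matchingsAvoiding_with_edge hw'.1 hw hw'.2, Finset.sum_filter]
    exact Finset.sum_congr rfl fun S _ => by split_ifs <;> simp
  rw [Finset.mul_sum, Finset.sum_congr rfl h1, Finset.sum_comm, deletedSum_insert_eq_sum_filter,
    Finset.sum_filter, ← Finset.sum_add_distrib, deletedSum]
  refine Finset.sum_congr rfl fun S hS => ?_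
  rw [← Finset.sum_mul, sum_edges_at_eq_ite hS]
  split_ifs <;> simp

theorem deletedSum_anti (ht : 0 ≤ t) {B : Finset V} (hAB : A ⊆ B) :
    deletedSum G B t ≤ deletedSum G A t :=
  Finset.sum_le_sum_of_subset_of_nonneg
    (fun S hS => mem_matchingsAvoiding.2 ⟨(mem_matchingsAvoiding.1 hS).1,
      fun e he v hv hA => (mem_matchingsAvoiding.1 hS).2 e he v hv (hAB hA)⟩)
    (fun _ _ _ => by positivity)

open scoped Classical in
/-- Deleting a vertex of degree `d` shrinks the generating function at most by `1 + d t`. -/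
theorem deletedSum_le_mul_insert [G.LocallyFinite] {d : ℕ} (hG : G.IsRegularOfDegree d)
    (ht : 0 ≤ t) (w : V) :
    deletedSum G A t ≤ (1 + d * t) * deletedSum G (insert w A) t := by
  have hpos := deletedSum_pos (G := G) (A := insert w A) ht
  by_cases hw : w ∈ A
  · rw [Finset.insert_eq_of_mem hw] at hpos ⊢
    nlinarith [mul_nonneg (mul_nonneg (Nat.cast_nonneg (α := ℝ) d) ht) hpos.le]
  rw [deletedSum_eq_add_sum hw, add_mul, one_mul, mul_comm (d : ℝ) t, mul_assoc]
  refine add_le_add_right (mul_le_mul_of_nonneg_left ?_ ht) _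
  calc ∑ w' with G.Adj w w' ∧ w' ∉ A, deletedSum G (insert w' (insert w A)) t
      ≤ ∑ w' with G.Adj w w' ∧ w' ∉ A, deletedSum G (insert w A) t :=
        Finset.sum_le_sum fun w' _ => deletedSum_anti ht (Finset.subset_insert _ _)
    _ ≤ ∑ w' ∈ G.neighborFinset w, deletedSum G (insert w A) t :=
        Finset.sum_le_sum_of_subset_of_nonneg (fun w' hw' => by
          simpa using (Finset.mem_filter.1 hw').2.1) fun _ _ _ => hpos.le
    _ = d * deletedSum G (insert w A) t := by
        rw [Finset.sum_const, SimpleGraph.card_neighborFinset_eq_degree, hG w, nsmul_eq_mul]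

open scoped Classical in
theorem deletedSum_le_pow_mul_union [G.LocallyFinite] {d : ℕ} (hG : G.IsRegularOfDegree d)
    (ht : 0 ≤ t) (B : Finset V) :
    deletedSum G A t ≤ (1 + d * t) ^ B.card * deletedSum G (B ∪ A) t := by
  induction B using Finset.induction_on with
  | empty => simp
  | insert w B hw ih =>
    rw [Finset.card_insert_of_notMem hw, pow_succ, mul_assoc, Finset.insert_union]
    exact ih.trans (by gcongr; exact deletedSum_le_mul_insert hG ht w)

/-! ### The correlation identity on bipartite graphs -/

open scoped Classical in
/-- For a `±1`-colouring `s`, the correlation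
`s u s v (M(H - u) M(H - v) - M(H) M(H - u - v))`, where `H = G - A`. -/
noncomputable def signedCorrelation (G : SimpleGraph V) (s : V → ℝ) (A : Finset V) (u v : V)
    (t : ℝ) : ℝ :=
  s u * s v * (deletedSum G (insert u A) t * deletedSum G (insert v A) t -
    deletedSum G A t * deletedSum G (insert v (insert u A)) t)

open scoped Classical in
/-- Expanding `M(H)` and `M(H - v)` at the vertex `u` expresses the correlation of `u` and `v`
through the correlations of `v` with the neighbours of `u` in `H - u`; passing to a neighbour
changes the sign of `s`, which absorbs the minus sign of the expansion. -/
theorem signedCorrelation_eq {s : V → ℝ} (hs1 : ∀ v, s v * s v = 1)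
    (hs : ∀ u v, G.Adj u v → s v = -s u) {u v : V} (hu : u ∉ A) (hv : v ∉ A) (huv : u ≠ v) :
    signedCorrelation G s A u v t =
      (if G.Adj u v then t * deletedSum G (insert v (insert u A)) t ^ 2 else 0) +
      t * ∑ w with (G.Adj u w ∧ w ∉ A) ∧ w ≠ v, signedCorrelation G s (insert u A) w v t := by
  have e1 := deletedSum_eq_add_sum (G := G) (t := t) hu
  have e2 := deletedSum_eq_add_sum (G := G) (A := insert v A) (t := t) (w := u)
    (by simp [huv, hu])
  have e3 : ({w | G.Adj u w ∧ w ∉ insert v A} : Finset V) =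
      ({w | (G.Adj u w ∧ w ∉ A) ∧ w ≠ v} : Finset V) := by
    ext w; simp; tauto
  have e4 : ∑ w with G.Adj u w ∧ w ∉ A, deletedSum G (insert w (insert u A)) t =
      (if G.Adj u v then deletedSum G (insert v (insert u A)) t else 0) +
      ∑ w with (G.Adj u w ∧ w ∉ A) ∧ w ≠ v, deletedSum G (insert w (insert u A)) t := by
    have hfil : ({w | (G.Adj u w ∧ w ∉ A) ∧ w ≠ v} : Finset V) =
        ({w | G.Adj u w ∧ w ∉ A} : Finset V).erase v := by
      ext w; simp; tauto
    rw [hfil]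
    split_ifs with h
    · rw [Finset.add_sum_erase _ (fun w => deletedSum G (insert w (insert u A)) t)
        (by simp [h, hv])]
    · rw [Finset.erase_eq_of_notMem (by simp [h]), zero_add]
  have e5 : ∑ w with (G.Adj u w ∧ w ∉ A) ∧ w ≠ v, signedCorrelation G s (insert u A) w v t =
      -(s u * s v) * ((∑ w with (G.Adj u w ∧ w ∉ A) ∧ w ≠ v,
        deletedSum G (insert w (insert u A)) t) * deletedSum G (insert v (insert u A)) t -
        deletedSum G (insert u A) t * ∑ w with (G.Adj u w ∧ w ∉ A) ∧ w ≠ v,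
          deletedSum G (insert w (insert v (insert u A))) t) := by
    rw [Finset.sum_mul, Finset.mul_sum, ← Finset.sum_sub_distrib, Finset.mul_sum]
    refine Finset.sum_congr rfl fun w hw => ?_
    simp only [Finset.mem_filter, Finset.mem_univ, true_and] at hw
    rw [signedCorrelation, hs u w hw.1.1, Finset.insert_comm v w]
    ring
  rw [e3, Finset.insert_comm u v] at e2
  rw [e4] at e1
  rw [e5, signedCorrelation, e1, e2]
  split_ifs with h
  · have : s u * s v = -1 := by rw [hs u v h, mul_neg, hs1]
    rw [this]; ring
  · ring

theorem signedCorrelation_nonneg {s : V → ℝ} (hs1 : ∀ v, s v * s v = 1)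
    (hs : ∀ u v, G.Adj u v → s v = -s u) (ht : 0 ≤ t) {u v : V} (hu : u ∉ A) (hv : v ∉ A)
    (huv : u ≠ v) : 0 ≤ signedCorrelation G s A u v t := by
  classical
  induction h : Aᶜ.card using Nat.strong_induction_on generalizing A u with
  | _ n ih =>
    rw [signedCorrelation_eq hs1 hs hu hv huv]
    refine add_nonneg (by split_ifs <;> positivity) (mul_nonneg ht (Finset.sum_nonneg ?_))
    intro w hw
    simp only [Finset.mem_filter, Finset.mem_univ, true_and] at hw
    refine ih _ ?_ (A := insert u A) ?_ ?_ hw.2 rfl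
    · rw [← h]
      exact Finset.card_lt_card (Finset.compl_ssubset_compl.2 (Finset.ssubset_insert hu))
    · simp [hw.1.2, hw.1.1.ne']
    · simp [hv, huv.symm]

open scoped Classical in
/-- The contribution of the path that consists of the edge `uv`. -/
theorem mul_sq_le_signedCorrelation_of_adj {s : V → ℝ} (hs1 : ∀ v, s v * s v = 1)
    (hs : ∀ u v, G.Adj u v → s v = -s u) (ht : 0 ≤ t) {u v : V} (hu : u ∉ A) (hv : v ∉ A)
    (huv : G.Adj u v) :
    t * deletedSum G (insert v (insert u A)) t ^ 2 ≤ signedCorrelation G s A u v t := by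
  rw [signedCorrelation_eq hs1 hs hu hv huv.ne, if_pos huv]
  refine le_add_of_nonneg_right (mul_nonneg ht (Finset.sum_nonneg fun x hx => ?_))
  simp only [Finset.mem_filter, Finset.mem_univ, true_and] at hx
  refine signedCorrelation_nonneg hs1 hs ht ?_ ?_ hx.2
  · simp [hx.1.2, hx.1.1.ne']
  · simp [hv, huv.ne']

open scoped Classical in
/-- Keeping one neighbour in `signedCorrelation_eq`. -/
theorem le_signedCorrelation_of_adj {s : V → ℝ} (hs1 : ∀ v, s v * s v = 1)
    (hs : ∀ u v, G.Adj u v → s v = -s u) (ht : 0 ≤ t) {u v w : V} (hu : u ∉ A) (hv : v ∉ A)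
    (huv : u ≠ v) (huw : G.Adj u w) (hw : w ∉ A) (hwv : w ≠ v) :
    (if G.Adj u v then t * deletedSum G (insert v (insert u A)) t ^ 2 else 0) +
      t * signedCorrelation G s (insert u A) w v t ≤ signedCorrelation G s A u v t := by
  rw [signedCorrelation_eq hs1 hs hu hv huv]
  gcongr
  refine Finset.single_le_sum (f := fun w => signedCorrelation G s (insert u A) w v t)
    (fun x hx => ?_) (by simp [*])
  simp only [Finset.mem_filter, Finset.mem_univ, true_and] at hx
  refine signedCorrelation_nonneg hs1 hs ht ?_ ?_ hx.2
  · simp [hx.1.2, hx.1.1.ne']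
  · simp [hv, huv.symm]

open scoped Classical in
/-- The contribution of a path, followed edge by edge through the recursion. -/
theorem pow_mul_sq_le_signedCorrelation {s : V → ℝ} (hs1 : ∀ v, s v * s v = 1)
    (hs : ∀ u v, G.Adj u v → s v = -s u) (ht : 0 ≤ t) {u v : V} (p : G.Walk u v)
    (hp : p.IsPath) (huv : u ≠ v) (hA : ∀ x ∈ p.support, x ∉ A) :
    t ^ p.length * deletedSum G (p.support.toFinset ∪ A) t ^ 2 ≤
      signedCorrelation G s A u v t := by
  induction p generalizing A with
  | nil => exact absurd rfl huv
  | @cons u w v h p ih =>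
    have hu : u ∉ A := hA u (by simp)
    have hv : v ∉ A := hA v (by simp)
    obtain ⟨hp', hup⟩ := (SimpleGraph.Walk.cons_isPath_iff _ _).1 hp
    by_cases hwv : w = v
    · subst hwv
      have hnil := (SimpleGraph.Walk.isPath_iff_nil.1 hp').eq_nil
      subst hnil
      have hset : (SimpleGraph.Walk.cons h SimpleGraph.Walk.nil).support.toFinset ∪ A =
          insert w (insert u A) := by
        ext x; simp; tauto
      rw [hset]
      simp only [SimpleGraph.Walk.length_cons, SimpleGraph.Walk.length_nil, zero_add, pow_one]
      exact mul_sq_le_signedCorrelation_of_adj hs1 hs ht hu hv h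
    · have hw : w ∉ A := hA w (by simp)
      have hset : (SimpleGraph.Walk.cons h p).support.toFinset ∪ A =
          p.support.toFinset ∪ insert u A := by
        ext x; simp
      have := ih (A := insert u A) hp' hwv fun x hx => by
        simp only [Finset.mem_insert, not_or]
        exact ⟨fun hxu => hup (hxu ▸ hx), hA x (by simp [hx])⟩
      refine le_trans ?_ (le_signedCorrelation_of_adj hs1 hs ht hu hv huv h hw hwv)
      rw [hset, SimpleGraph.Walk.length_cons, pow_succ', mul_assoc]
      refine le_trans ?_ (le_add_of_nonneg_left (by split_ifs <;> positivity))
      gcongr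

end Combinatorics

/-! ### The density at a vertex and the comparison with the tree -/

/-- The bipartition as a `±1`-valued function. -/
theorem exists_sign_of_isBipartite {G : SimpleGraph V} (h : G.IsBipartite) :
    ∃ s : V → ℝ, (∀ v, s v * s v = 1) ∧ ∀ u v, G.Adj u v → s v = -s u := by
  obtain ⟨c⟩ := h
  refine ⟨fun v => if c v = 0 then 1 else -1, fun v => by by_cases h : c v = 0 <;> simp [h], ?_⟩
  intro u v huv
  have := c.valid huv
  have h1 : c u = 0 ∨ c u = 1 := by omega
  have h2 : c v = 0 ∨ c v = 1 := by omega
  rcases h1 with h1 | h1 <;> rcases h2 with h2 | h2 <;> simp_all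

theorem exists_adj_of_isRegularOfDegree [Nonempty V] {G : SimpleGraph V} [G.LocallyFinite]
    {d : ℕ} (hd : 0 < d) (hreg : G.IsRegularOfDegree d) :
    ∃ u v, G.Adj u v := by
  obtain ⟨u⟩ := ‹Nonempty V›
  have h : (G.neighborFinset u).Nonempty := by
    rw [← Finset.card_pos, SimpleGraph.card_neighborFinset_eq_degree, hreg u]; exact hd
  obtain ⟨v, hv⟩ := h
  exact ⟨u, v, by simpa using hv⟩

section Density

variable [Fintype V] {G : SimpleGraph V} {S : Finset (Sym2 V)} {t : ℝ}

open scoped Classical in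
theorem card_covered_eq (hS : IsEdgeMatching G S) :
    ({v | ∃ e ∈ S, v ∈ e} : Finset V).card = 2 * S.card := by
  have h : ({v | ∃ e ∈ S, v ∈ e} : Finset V) = S.biUnion Sym2.toFinset := by
    ext v; simp
  rw [h, Finset.card_biUnion, Finset.sum_congr rfl fun e he =>
    Sym2.card_toFinset_of_not_isDiag e (G.not_isDiag_of_mem_edgeSet (hS.1 e he))]
  · simp [mul_comm]
  · intro e he f hf hne
    exact Finset.disjoint_left.2 fun v hv hv' =>
      hS.2 e he f hf hne v (Sym2.mem_toFinset.1 hv) (Sym2.mem_toFinset.1 hv')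

theorem two_mul_card_le (hS : IsEdgeMatching G S) : 2 * S.card ≤ Fintype.card V := by
  classical
  rw [← card_covered_eq hS]
  exact Finset.card_le_univ _

theorem covers_iff_two_mul_card_eq (hS : IsEdgeMatching G S) :
    (∀ v : V, ∃ e ∈ S, v ∈ e) ↔ 2 * S.card = Fintype.card V := by
  classical
  rw [← card_covered_eq hS, Finset.card_eq_iff_eq_univ, Finset.eq_univ_iff_forall]
  simp

theorem mem_matchingsAvoiding_empty : S ∈ matchingsAvoiding G ∅ ↔ IsEdgeMatching G S := by
  simp [mem_matchingsAvoiding]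

open scoped Classical in
theorem numMatchings_eq_card (k : ℕ) :
    numMatchings G k = ({S ∈ matchingsAvoiding G ∅ | S.card = k}).card := by
  rw [numMatchings, ← Set.ncard_coe_finset]
  congr 1
  ext S
  simp [mem_matchingsAvoiding_empty]

theorem matchingGenPoly_eq_sum :
    matchingGenPoly G = ∑ S ∈ matchingsAvoiding G ∅, (Polynomial.X : Polynomial ℝ) ^ S.card := by
  classical
  rw [matchingGenPoly, ← Finset.sum_fiberwise_of_maps_to (g := Finset.card)
    (t := Finset.range (Fintype.card V / 2 + 1))]
  · refine Finset.sum_congr rfl fun k _ => ?_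
    rw [numMatchings_eq_card, Finset.sum_congr rfl fun S hS => by
      rw [(Finset.mem_filter.1 hS).2]]
    simp
  · intro S hS
    have := two_mul_card_le (mem_matchingsAvoiding_empty.1 hS)
    simp only [Finset.mem_range]
    omega

theorem eval_matchingGenPoly : (matchingGenPoly G).eval t = deletedSum G ∅ t := by
  simp [matchingGenPoly_eq_sum, deletedSum, Polynomial.eval_finsetSum]

theorem mul_eval_derivative_matchingGenPoly :
    t * (matchingGenPoly G).derivative.eval t =
      ∑ S ∈ matchingsAvoiding G ∅, (S.card : ℝ) * t ^ S.card := by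
  rw [matchingGenPoly_eq_sum, Polynomial.derivative_sum, Polynomial.eval_finsetSum,
    Finset.mul_sum]
  refine Finset.sum_congr rfl fun S _ => ?_
  rcases Nat.eq_zero_or_pos S.card with h | h
  · simp [h]
  · have : t ^ S.card = t * t ^ (S.card - 1) := by rw [← pow_succ', Nat.sub_add_cancel h]
    rw [this, Polynomial.derivative_X_pow, Polynomial.eval_mul, Polynomial.eval_C,
      Polynomial.eval_pow, Polynomial.eval_X]
    ring

theorem eval_matchingGenPoly_pos (ht : 0 ≤ t) : 0 < (matchingGenPoly G).eval t := by
  rw [eval_matchingGenPoly]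
  exact deletedSum_pos ht

theorem one_sub_density_mul [Nonempty V] (ht : 0 ≤ t) :
    (1 - density G t) * (Fintype.card V * deletedSum G ∅ t) =
      ∑ S ∈ matchingsAvoiding G ∅, ((Fintype.card V : ℝ) - 2 * S.card) * t ^ S.card := by
  have hZ := (deletedSum_pos (G := G) (A := ∅) ht).ne'
  have hV : (Fintype.card V : ℝ) ≠ 0 := by exact_mod_cast Fintype.card_ne_zero
  have h : density G t * (Fintype.card V * deletedSum G ∅ t) =
      2 * ∑ S ∈ matchingsAvoiding G ∅, (S.card : ℝ) * t ^ S.card := by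
    rw [density, mul_eval_derivative_matchingGenPoly, eval_matchingGenPoly]
    field_simp
  rw [sub_mul, one_mul, h, deletedSum, Finset.mul_sum, Finset.mul_sum, ← Finset.sum_sub_distrib]
  exact Finset.sum_congr rfl fun S _ => by ring

/-- Both sides count pairs of a matching and a vertex it does not cover. -/
theorem sum_deletedSum_singleton :
    ∑ v, deletedSum G {v} t =
      ∑ S ∈ matchingsAvoiding G ∅, ((Fintype.card V : ℝ) - 2 * S.card) * t ^ S.card := by
  classical
  have h1 : ∀ v, deletedSum G {v} t =
      ∑ S ∈ matchingsAvoiding G ∅, if (∀ e ∈ S, v ∉ e) then t ^ S.card else 0 := fun v => by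
    rw [← insert_empty_eq, deletedSum_insert_eq_sum_filter, Finset.sum_filter]
  rw [Finset.sum_congr rfl fun v _ => h1 v, Finset.sum_comm]
  refine Finset.sum_congr rfl fun S hS => ?_
  have h2 := card_covered_eq (mem_matchingsAvoiding_empty.1 hS)
  have h3 := Finset.card_filter_add_card_filter_not (s := (Finset.univ : Finset V))
    (fun v => ∃ e ∈ S, v ∈ e)
  rw [h2, Finset.card_univ] at h3
  rw [← Finset.sum_filter, Finset.sum_const, nsmul_eq_mul, ← h3]
  push Not
  push_cast
  ring

open scoped Classical in
theorem deletedSum_map (φ : G ≃g G) (u : V) : deletedSum G {φ u} t = deletedSum G {u} t := by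
  have key : ∀ (ψ : G ≃g G) (v : V), ∀ S ∈ matchingsAvoiding G {v},
      S.image (Sym2.map ψ) ∈ matchingsAvoiding G {ψ v} := by
    intro ψ v S hS
    obtain ⟨⟨h1, h2⟩, h3⟩ := mem_matchingsAvoiding.1 hS
    refine mem_matchingsAvoiding.2 ⟨⟨?_, ?_⟩, ?_⟩
    · intro e he
      obtain ⟨f, hf, rfl⟩ := Finset.mem_image.1 he
      induction f with
      | _ x y => exact ψ.map_adj_iff.2 (h1 _ hf)
    · intro e he e' he' hne x hx hx'
      obtain ⟨f, hf, rfl⟩ := Finset.mem_image.1 he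
      obtain ⟨f', hf', rfl⟩ := Finset.mem_image.1 he'
      obtain ⟨a, ha, rfl⟩ := Sym2.mem_map.1 hx
      obtain ⟨b, hb, hab⟩ := Sym2.mem_map.1 hx'
      rw [ψ.injective hab] at hb
      exact h2 f hf f' hf' (fun h => hne (by rw [h])) a ha hb
    · intro e he x hx hxv
      obtain ⟨f, hf, rfl⟩ := Finset.mem_image.1 he
      obtain ⟨a, ha, rfl⟩ := Sym2.mem_map.1 hx
      exact h3 f hf a ha (by simpa using hxv)
  have inv : ∀ (ψ : G ≃g G) (S : Finset (Sym2 V)),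
      (S.image (Sym2.map ψ)).image (Sym2.map ψ.symm) = S := by
    intro ψ S
    rw [Finset.image_image, ← Sym2.map_comp]
    have : (ψ.symm : V → V) ∘ ψ = id := by ext; simp
    rw [this, Sym2.map_id, Finset.image_id]
  symm
  refine Finset.sum_bij' (fun S _ => S.image (Sym2.map φ)) (fun S _ => S.image (Sym2.map φ.symm))
    (key φ u) (fun S hS => by simpa using key φ.symm (φ u) S hS) (fun S _ => inv φ S)
    (fun S _ => by simpa using inv φ.symm S) fun S _ => ?_
  rw [Finset.card_image_of_injective _ (Sym2.map.injective φ.injective)]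

/-- In a vertex-transitive graph every vertex is uncovered with the same probability. -/
theorem deletedSum_singleton_eq [Nonempty V] (hG : IsVertexTransitive G) (ht : 0 ≤ t) (v : V) :
    deletedSum G {v} t = (1 - density G t) * deletedSum G ∅ t := by
  have hV : (Fintype.card V : ℝ) ≠ 0 := by exact_mod_cast Fintype.card_ne_zero
  have h : ∑ w, deletedSum G {w} t = Fintype.card V * deletedSum G {v} t := by
    rw [Finset.sum_congr rfl fun w _ => show deletedSum G {w} t = deletedSum G {v} t by
      obtain ⟨φ, rfl⟩ := hG v w
      exact deletedSum_map φ v]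
    simp
  rw [sum_deletedSum_singleton, ← one_sub_density_mul ht] at h
  apply mul_left_cancel₀ hV
  rw [← h]
  ring

open scoped Classical in
/-- The law of total probability at `v` together with the correlation inequalities on the `d`
edges at `v`. With `x_w` the probability of the edge `vw`, the correlation inequality reads
`x_w - t (1 - p) ^ 2 ≥ x_w ^ 2`, with an additional term `t ρ` for one of the edges; the sum of
the `x_w` is `p`, and Cauchy–Schwarz bounds the sum of their squares from below. -/
theorem density_mul_ge [Nonempty V] [G.LocallyFinite] {d : ℕ} (hd : 0 < d)
    (hreg : G.IsRegularOfDegree d) (htrans : IsVertexTransitive G) {s : V → ℝ}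
    (hs1 : ∀ v, s v * s v = 1) (hs : ∀ u v, G.Adj u v → s v = -s u) (ht : 0 < t)
    {v w₀ : V} (hvw : G.Adj v w₀) {ρ : ℝ}
    (hρ : t * deletedSum G {w₀, v} t ^ 2 + ρ * deletedSum G ∅ t ^ 2 ≤
      signedCorrelation G s ∅ v w₀ t) :
    d * t * (1 - density G t) ^ 2 + t * ρ ≤ density G t * (1 - density G t / d) := by
  set p := density G t with hp
  set Z := deletedSum G ∅ t with hZ
  have hZpos : 0 < Z := deletedSum_pos ht.le
  have hsing : ∀ u, deletedSum G {u} t = (1 - p) * Z := fun u =>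
    deletedSum_singleton_eq htrans ht.le u
  let x : V → ℝ := fun w => t * deletedSum G {w, v} t / Z
  let r : V → ℝ := fun w => if w = w₀ then ρ else 0
  have hsum : ∑ w ∈ G.neighborFinset v, x w = p := by
    have h := deletedSum_eq_add_sum (G := G) (A := ∅) (t := t) (w := v) (by simp)
    have hN : ({w' | G.Adj v w' ∧ w' ∉ (∅ : Finset V)} : Finset V) = G.neighborFinset v := by
      ext; simp
    rw [hN, ← hZ, insert_empty_eq, hsing] at h
    rw [← Finset.sum_div, ← Finset.mul_sum, div_eq_iff hZpos.ne']
    linarith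
  have hcorr : ∀ w ∈ G.neighborFinset v, x w ^ 2 + t * r w + t * (1 - p) ^ 2 ≤ x w := by
    intro w hw
    have hadj : G.Adj v w := by simpa using hw
    have hsv : s v * s w = -1 := by rw [hs v w hadj, mul_neg, hs1]
    have hle : t * deletedSum G {w, v} t ^ 2 + r w * Z ^ 2 ≤ signedCorrelation G s ∅ v w t := by
      by_cases hww : w = w₀
      · subst hww; simpa [r] using hρ
      · simpa [r, hww] using mul_sq_le_signedCorrelation_of_adj (A := ∅) hs1 hs ht.le
          (by simp) (by simp) hadj
    rw [signedCorrelation, hsv, insert_empty_eq, insert_empty_eq, hsing, hsing, ← hZ] at hle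
    have e : x w - (x w ^ 2 + t * r w + t * (1 - p) ^ 2) = t / Z ^ 2 *
        (-1 * ((1 - p) * Z * ((1 - p) * Z) - Z * deletedSum G {w, v} t) -
          (t * deletedSum G {w, v} t ^ 2 + r w * Z ^ 2)) := by
      simp only [x]
      field_simp
      ring
    have : 0 ≤ t / Z ^ 2 *
        (-1 * ((1 - p) * Z * ((1 - p) * Z) - Z * deletedSum G {w, v} t) -
          (t * deletedSum G {w, v} t ^ 2 + r w * Z ^ 2)) :=
      mul_nonneg (by positivity) (by linarith)
    linarith
  have hr : ∑ w ∈ G.neighborFinset v, r w = ρ := by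
    simp [r, hvw]
  have hcard : (G.neighborFinset v).card = d := by
    rw [SimpleGraph.card_neighborFinset_eq_degree, hreg v]
  have hfin := Finset.sum_le_sum hcorr
  rw [Finset.sum_add_distrib, Finset.sum_add_distrib, ← Finset.mul_sum, hr, hsum,
    Finset.sum_const, hcard, nsmul_eq_mul] at hfin
  have hcs := sq_sum_le_card_mul_sum_sq (s := G.neighborFinset v) (f := x)
  rw [hsum, hcard] at hcs
  have hd' : (0 : ℝ) < d := by exact_mod_cast hd
  have h2 : p ^ 2 / d ≤ ∑ w ∈ G.neighborFinset v, x w ^ 2 := by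
    rw [div_le_iff₀ hd', mul_comm]; exact hcs
  have h3 : p * (1 - p / d) = p - p ^ 2 / d := by ring
  rw [h3]
  linarith

/-- The activity of a `d`-regular vertex-transitive bipartite graph at density `p` is at most
that of the infinite `d`-regular tree, which is `p (1 - p / d) / (d (1 - p) ^ 2)`. -/
theorem density_ge_tree [Nonempty V] [G.LocallyFinite] {d : ℕ} (hd : 0 < d)
    (hreg : G.IsRegularOfDegree d) (htrans : IsVertexTransitive G) (hbip : G.IsBipartite)
    (ht : 0 < t) :
    d * t * (1 - density G t) ^ 2 ≤ density G t * (1 - density G t / d) := by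
  classical
  obtain ⟨s, hs1, hs⟩ := exists_sign_of_isBipartite hbip
  obtain ⟨v, w, hadj⟩ := exists_adj_of_isRegularOfDegree hd hreg
  refine le_of_eq_of_le ?_ (density_mul_ge hd hreg htrans hs1 hs ht hadj (ρ := 0) ?_)
  · simp
  · simpa using mul_sq_le_signedCorrelation_of_adj (A := ∅) hs1 hs ht.le (by simp) (by simp) hadj

/-- An uncovered vertex has probability at least `1 / (1 + d t)`. -/
theorem one_le_mul_one_sub_density [Nonempty V] [G.LocallyFinite] {d : ℕ}
    (hreg : G.IsRegularOfDegree d) (htrans : IsVertexTransitive G) (ht : 0 ≤ t) :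
    1 ≤ (1 + d * t) * (1 - density G t) := by
  classical
  obtain ⟨v⟩ := ‹Nonempty V›
  have : Nonempty V := ⟨v⟩
  have h := deletedSum_le_mul_insert (A := ∅) hreg ht v
  rw [insert_empty_eq, deletedSum_singleton_eq htrans ht, ← mul_assoc] at h
  exact le_of_mul_le_mul_right (by simpa using h) (deletedSum_pos (G := G) (A := ∅) ht)

/-- A cycle of length `l` improves `density_ge_tree`: its edges other than `vw` form a path from
`w` to `v`, which contributes `t ^ (l - 1) (M(G - C) / M(G)) ^ 2` to the correlation. -/
theorem density_ge_of_cycle [Nonempty V] [G.LocallyFinite] {d l : ℕ} (hd : 0 < d)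
    (hreg : G.IsRegularOfDegree d) (htrans : IsVertexTransitive G) (hbip : G.IsBipartite)
    (hcyc : HasCycleOfLength G l) (ht : 0 < t) :
    t * (1 - density G t) ^ 2 * (d + (t / (1 + d * t) ^ 2) ^ (l - 1)) ≤
      density G t * (1 - density G t / d) := by
  classical
  obtain ⟨s, hs1, hs⟩ := exists_sign_of_isBipartite hbip
  obtain ⟨v, c, hc, rfl⟩ := hcyc
  cases c with
  | nil => exact absurd hc (by simp)
  | @cons _ w _ hvw q =>
    obtain ⟨hq, hqe⟩ := (SimpleGraph.Walk.cons_isCycle_iff _ _).1 hc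
    have hlen := hc.three_le_length
    rw [SimpleGraph.Walk.length_cons] at hlen ⊢
    rw [Nat.add_sub_cancel]
    have hbase : (0 : ℝ) < 1 + d * t := by positivity
    have hZ := deletedSum_pos (G := G) (A := ∅) ht.le
    set p := density G t with hp
    set C := q.support.toFinset with hC
    have hcardC : C.card = q.length + 1 := by
      rw [hC, List.toFinset_card_of_nodup hq.support_nodup, SimpleGraph.Walk.length_support]
    have hwC : v ∈ C := by simp [hC]
    -- The first deleted vertex costs the factor `1 - p`, each further one at least `1 / (1 + dt)`.
    have hdel : (1 - p) * deletedSum G ∅ t ≤ (1 + d * t) ^ q.length * deletedSum G C t := by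
      have := deletedSum_le_pow_mul_union (A := {v}) hreg ht.le (C.erase v)
      rw [Finset.card_erase_of_mem hwC, hcardC, Nat.add_sub_cancel,
        deletedSum_singleton_eq htrans ht.le, Finset.union_comm, ← Finset.insert_eq,
        Finset.insert_erase hwC] at this
      exact this
    have hp1 : 0 ≤ 1 - p := by
      have := one_le_mul_one_sub_density hreg htrans ht.le
      nlinarith
    have hcorr : t * deletedSum G {v, w} t ^ 2 + t ^ q.length * deletedSum G C t ^ 2 ≤
        signedCorrelation G s ∅ w v t := by
      cases q with
      | nil => simp at hlen
      | @cons _ x _ hwx q' =>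
        obtain ⟨hq', hwq'⟩ := (SimpleGraph.Walk.cons_isPath_iff _ _).1 hq
        have hxv : x ≠ v := by
          rintro rfl
          exact hqe (by simp [Sym2.eq_swap])
        refine le_trans ?_ (le_signedCorrelation_of_adj hs1 hs ht.le (by simp) (by simp)
          hvw.ne' hwx (by simp) hxv)
        rw [if_pos hvw.symm, insert_empty_eq, SimpleGraph.Walk.length_cons, pow_succ' t, mul_assoc]
        refine add_le_add_right (mul_le_mul_of_nonneg_left ?_ ht.le) _
        have := pow_mul_sq_le_signedCorrelation (A := {w}) hs1 hs ht.le q' hq' hxv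
          (fun y hy hyw => hwq' (by simpa using (Finset.mem_singleton.1 hyw) ▸ hy))
        refine le_of_eq_of_le ?_ this
        congr 3
        rw [hC]
        ext y
        simp
    have hmain := density_mul_ge hd hreg htrans hs1 hs ht hvw.symm
      (ρ := t ^ q.length * (deletedSum G C t / deletedSum G ∅ t) ^ 2) (by
        refine le_of_eq_of_le ?_ hcorr
        field_simp)
    refine le_trans ?_ hmain
    have hratio : (1 - p) / (1 + d * t) ^ q.length ≤ deletedSum G C t / deletedSum G ∅ t := by
      rw [div_le_div_iff₀ (by positivity) hZ, mul_comm (deletedSum G C t)]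
      exact hdel
    have hsq : ((1 - p) / (1 + d * t) ^ q.length) ^ 2 ≤
        (deletedSum G C t / deletedSum G ∅ t) ^ 2 :=
      pow_le_pow_left₀ (by positivity) hratio 2
    calc t * (1 - p) ^ 2 * (d + (t / (1 + d * t) ^ 2) ^ q.length)
        = d * t * (1 - p) ^ 2 +
            t * (t ^ q.length * ((1 - p) / (1 + d * t) ^ q.length) ^ 2) := by
          rw [div_pow, div_pow, ← pow_mul, ← pow_mul, mul_comm 2]
          ring
      _ ≤ _ := by gcongr

end Density

/-! ### Density and free entropy as functions of the activity -/

section Analysis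

variable [Fintype V] {G : SimpleGraph V} {t : ℝ}

theorem density_zero : density G 0 = 0 := by simp [density]

theorem freeEntropy_zero : freeEntropy G 0 = 0 := by
  have h : (matchingGenPoly G).eval 0 = 1 := by
    rw [eval_matchingGenPoly, deletedSum, Finset.sum_eq_single ∅]
    · simp
    · intro S _ hS
      exact zero_pow (Finset.card_ne_zero.2 (Finset.nonempty_iff_ne_empty.2 hS))
    · exact fun h => absurd empty_mem_matchingsAvoiding h
  simp [freeEntropy, h]

theorem density_nonneg (ht : 0 ≤ t) : 0 ≤ density G t := by
  rw [density, mul_eval_derivative_matchingGenPoly]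
  have := eval_matchingGenPoly_pos (G := G) ht
  positivity

theorem density_lt_one [Nonempty V] (ht : 0 ≤ t) : density G t < 1 := by
  have hV : (0 : ℝ) < Fintype.card V := by exact_mod_cast Fintype.card_pos
  have hZ := deletedSum_pos (G := G) (A := ∅) ht
  have h := one_sub_density_mul (G := G) ht
  have hpos : 0 < ∑ S ∈ matchingsAvoiding G ∅,
      ((Fintype.card V : ℝ) - 2 * S.card) * t ^ S.card := by
    refine Finset.sum_pos' (fun S hS => ?_) ⟨∅, empty_mem_matchingsAvoiding, by simpa using hV⟩
    have : (2 * S.card : ℝ) ≤ Fintype.card V := by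
      exact_mod_cast two_mul_card_le (mem_matchingsAvoiding_empty.1 hS)
    exact mul_nonneg (by linarith) (by positivity)
  rw [← h] at hpos
  have := pos_of_mul_pos_left hpos (by positivity)
  linarith

/-- The variance of the size of a random matching is positive; the empty matching is what makes
the Cauchy–Schwarz inequality strict. -/
theorem sq_sum_card_lt {u v : V} (huv : G.Adj u v) (ht : 0 < t) :
    (∑ S ∈ matchingsAvoiding G ∅, (S.card : ℝ) * t ^ S.card) ^ 2 <
      (∑ S ∈ matchingsAvoiding G ∅, (S.card : ℝ) ^ 2 * t ^ S.card) *
        ∑ S ∈ matchingsAvoiding G ∅, t ^ S.card := by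
  classical
  have he := empty_mem_matchingsAvoiding (G := G) (A := ∅)
  rw [← Finset.add_sum_erase _ _ he, ← Finset.add_sum_erase _ _ he,
    ← Finset.add_sum_erase _ (fun S : Finset (Sym2 V) => t ^ S.card) he]
  set M := (matchingsAvoiding G ∅).erase ∅
  have hpos : 0 < ∑ S ∈ M, (S.card : ℝ) ^ 2 * t ^ S.card := by
    refine Finset.sum_pos' (fun S _ => by positivity) ⟨{s(u, v)}, ?_, by simpa using ht⟩
    simp [M, mem_matchingsAvoiding_empty, IsEdgeMatching, huv]
  have hcs := Finset.sum_sq_le_sum_mul_sum_of_sq_le_mul M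
    (r := fun S => (S.card : ℝ) * t ^ S.card) (f := fun S => (S.card : ℝ) ^ 2 * t ^ S.card)
    (g := fun S => t ^ S.card) (fun _ _ => by positivity) (fun _ _ => by positivity)
    (fun _ _ => le_of_eq (by ring))
  simp only [Finset.card_empty, Nat.cast_zero, pow_zero, zero_mul, zero_add, ne_eq,
    OfNat.ofNat_ne_zero, not_false_eq_true, zero_pow]
  linarith

theorem mul_eval_derivative_X_mul_derivative :
    t * (Polynomial.X * (matchingGenPoly G).derivative).derivative.eval t =
      ∑ S ∈ matchingsAvoiding G ∅, (S.card : ℝ) ^ 2 * t ^ S.card := by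
  have h : Polynomial.X * (matchingGenPoly G).derivative =
      ∑ S ∈ matchingsAvoiding G ∅, Polynomial.C (S.card : ℝ) * Polynomial.X ^ S.card := by
    rw [matchingGenPoly_eq_sum, Polynomial.derivative_sum, Finset.mul_sum]
    refine Finset.sum_congr rfl fun S _ => ?_
    rcases Nat.eq_zero_or_pos S.card with h | h
    · simp [h]
    · rw [Polynomial.derivative_X_pow, mul_left_comm, ← pow_succ', Nat.sub_add_cancel h]
  rw [h, Polynomial.derivative_sum, Polynomial.eval_finsetSum, Finset.mul_sum]
  refine Finset.sum_congr rfl fun S _ => ?_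
  rcases Nat.eq_zero_or_pos S.card with h | h
  · simp [h]
  · have : t ^ S.card = t * t ^ (S.card - 1) := by rw [← pow_succ', Nat.sub_add_cancel h]
    rw [this, Polynomial.derivative_C_mul, Polynomial.derivative_X_pow, Polynomial.eval_mul,
      Polynomial.eval_mul, Polynomial.eval_C, Polynomial.eval_pow, Polynomial.eval_X]
    ring

theorem exists_hasDerivAt_density_pos [Nonempty V] {u v : V} (huv : G.Adj u v) (ht : 0 < t) :
    ∃ p', 0 < p' ∧ HasDerivAt (density G) p' t := by
  have hV : (0 : ℝ) < Fintype.card V := by exact_mod_cast Fintype.card_pos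
  have hP := eval_matchingGenPoly_pos (G := G) ht.le
  set P := matchingGenPoly G with hPdef
  have h1 := (Polynomial.X * P.derivative).hasDerivAt t
  have h2 := (P.hasDerivAt t).const_mul ((Fintype.card V : ℝ) / 2)
  have h3 := h1.div h2 (by positivity)
  refine ⟨_, ?_, h3.congr_of_eventuallyEq (Eventually.of_forall fun x => ?_)⟩
  · refine div_pos ?_ (by positivity)
    have h4 := sq_sum_card_lt huv ht
    rw [← mul_eval_derivative_X_mul_derivative, ← mul_eval_derivative_matchingGenPoly] at h4
    change _ < _ * deletedSum G ∅ t at h4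
    rw [← eval_matchingGenPoly, ← hPdef] at h4
    refine pos_of_mul_pos_right (a := t) ?_ ht.le
    rw [Polynomial.eval_mul (p := Polynomial.X), Polynomial.eval_X]
    nlinarith
  · simp [density, hPdef]

theorem continuousOn_density [Nonempty V] : ContinuousOn (density G) (Set.Ici 0) := by
  have hV : (0 : ℝ) < Fintype.card V := by exact_mod_cast Fintype.card_pos
  unfold density
  refine ContinuousOn.div (by fun_prop) (by fun_prop) fun t ht => ?_
  have := eval_matchingGenPoly_pos (G := G) (Set.mem_Ici.1 ht)
  positivity

theorem strictMonoOn_density [Nonempty V] {u v : V} (huv : G.Adj u v) :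
    StrictMonoOn (density G) (Set.Ici 0) := by
  refine strictMonoOn_of_deriv_pos (convex_Ici 0) continuousOn_density fun t ht => ?_
  rw [interior_Ici] at ht
  obtain ⟨p', hp', h⟩ := exists_hasDerivAt_density_pos huv ht
  rwa [h.deriv]

/-- The singularity of `log t` at `0` is absorbed by the factor `t` of the density. -/
theorem continuousOn_freeEntropy [Nonempty V] : ContinuousOn (freeEntropy G) (Set.Ici 0) := by
  have hV : (0 : ℝ) < Fintype.card V := by exact_mod_cast Fintype.card_pos
  have h : freeEntropy G = fun t => Real.log ((matchingGenPoly G).eval t) / Fintype.card V -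
      1 / 2 * ((matchingGenPoly G).derivative.eval t /
        ((Fintype.card V : ℝ) / 2 * (matchingGenPoly G).eval t)) * (t * Real.log t) := by
    ext t
    rw [freeEntropy, density]
    ring
  rw [h]
  have hP : ∀ t ∈ Set.Ici (0 : ℝ), (matchingGenPoly G).eval t ≠ 0 := fun t ht =>
    (eval_matchingGenPoly_pos (Set.mem_Ici.1 ht)).ne'
  refine ContinuousOn.sub (ContinuousOn.div_const (ContinuousOn.log (by fun_prop) hP) _)
    (ContinuousOn.mul (ContinuousOn.mul continuousOn_const (ContinuousOn.div (by fun_prop)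
      (by fun_prop) fun t ht => ?_)) Real.continuous_mul_log.continuousOn)
  exact mul_ne_zero (by positivity) (hP t ht)

theorem hasDerivAt_freeEntropy [Nonempty V] {p' : ℝ} (ht : 0 < t)
    (hp : HasDerivAt (density G) p' t) :
    HasDerivAt (freeEntropy G) (-(1 / 2) * p' * Real.log t) t := by
  have hV : (0 : ℝ) < Fintype.card V := by exact_mod_cast Fintype.card_pos
  have hP := eval_matchingGenPoly_pos (G := G) ht.le
  have h := ((((matchingGenPoly G).hasDerivAt t).log hP.ne').div_const (Fintype.card V : ℝ)).sub
    ((hp.const_mul (1 / 2)).mul (Real.hasDerivAt_log ht.ne'))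
  refine h.congr_deriv ?_
  rw [density]
  field_simp
  ring

/-! ### Large activities and perfect matchings -/

theorem numPerfectMatchings_eq_card [DecidableEq V] :
    numPerfectMatchings G =
      ({S ∈ matchingsAvoiding G ∅ | 2 * S.card = Fintype.card V}).card := by
  rw [numPerfectMatchings, ← Set.ncard_coe_finset]
  congr 1
  ext S
  simp only [Set.mem_ofPred_eq, Finset.coe_filter, mem_matchingsAvoiding_empty]
  exact and_congr_right fun hS => covers_iff_two_mul_card_eq hS

theorem sum_perfect_eq [DecidableEq V] :
    ∑ S ∈ matchingsAvoiding G ∅ with 2 * S.card = Fintype.card V, t ^ S.card =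
      numPerfectMatchings G * t ^ (Fintype.card V / 2) := by
  rw [numPerfectMatchings_eq_card, Finset.sum_congr rfl fun S hS => by
    rw [show S.card = Fintype.card V / 2 by have := (Finset.mem_filter.1 hS).2; omega]]
  simp

theorem numPerfectMatchings_mul_pow_le (ht : 0 ≤ t) :
    numPerfectMatchings G * t ^ (Fintype.card V / 2) ≤ deletedSum G ∅ t := by
  classical
  rw [← sum_perfect_eq]
  exact Finset.sum_le_sum_of_subset_of_nonneg (Finset.filter_subset _ _)
    fun _ _ _ => by positivity

/-- A matching that is not perfect leaves a vertex uncovered, so its probability is at most the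
expected number of uncovered vertices. -/
theorem le_numPerfectMatchings_mul_pow [Nonempty V] (ht : 0 ≤ t) :
    (1 - (1 - density G t) * Fintype.card V) * deletedSum G ∅ t ≤
      numPerfectMatchings G * t ^ (Fintype.card V / 2) := by
  classical
  have h := one_sub_density_mul (G := G) ht
  have h2 : deletedSum G ∅ t - numPerfectMatchings G * t ^ (Fintype.card V / 2) ≤
      ∑ S ∈ matchingsAvoiding G ∅, ((Fintype.card V : ℝ) - 2 * S.card) * t ^ S.card := by
    rw [← sum_perfect_eq, deletedSum, Finset.sum_filter, ← Finset.sum_sub_distrib]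
    refine Finset.sum_le_sum fun S hS => ?_
    have h3 := two_mul_card_le (mem_matchingsAvoiding_empty.1 hS)
    split_ifs with h4
    · rw [← h4]; simp
    · have : (1 : ℝ) ≤ Fintype.card V - 2 * S.card := by
        have : 2 * S.card + 1 ≤ Fintype.card V := by omega
        have : (2 * S.card + 1 : ℝ) ≤ Fintype.card V := by exact_mod_cast this
        linarith
      rw [sub_zero]
      exact le_mul_of_one_le_left (by positivity) this
  linarith

section Regular

variable [Nonempty V] [G.LocallyFinite] {d : ℕ}

/-- The comparison with the tree forces the density to `1` at an explicit rate, which is fast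
enough to beat `log t`. -/
theorem one_sub_density_le_sqrt (hd : 0 < d) (hreg : G.IsRegularOfDegree d)
    (htrans : IsVertexTransitive G) (hbip : G.IsBipartite) (ht : 0 < t) :
    1 - density G t ≤ √t⁻¹ := by
  have h := density_ge_tree hd hreg htrans hbip ht
  have h0 := density_nonneg (G := G) ht.le
  have h1 := density_lt_one (G := G) ht.le
  have hd' : (1 : ℝ) ≤ d := by exact_mod_cast hd
  refine Real.le_sqrt_of_sq_le ?_
  rw [← one_div, le_div_iff₀ ht]
  have h2 : density G t * (1 - density G t / d) ≤ 1 := by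
    have : 0 ≤ density G t / d := by positivity
    nlinarith
  have h3 : t * (1 - density G t) ^ 2 ≤ d * (t * (1 - density G t) ^ 2) :=
    le_mul_of_one_le_left (by positivity) hd'
  linarith

theorem tendsto_sqrt_inv_atTop : Tendsto (fun t : ℝ => √t⁻¹) atTop (𝓝 0) := by
  have := (Real.continuous_sqrt.tendsto 0).comp tendsto_inv_atTop_zero
  rwa [Real.sqrt_zero] at this

theorem tendsto_density_atTop (hd : 0 < d) (hreg : G.IsRegularOfDegree d)
    (htrans : IsVertexTransitive G) (hbip : G.IsBipartite) :
    Tendsto (density G) atTop (𝓝 1) := by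
  have h : Tendsto (fun t : ℝ => 1 - √t⁻¹) atTop (𝓝 1) := by
    simpa using tendsto_sqrt_inv_atTop.const_sub 1
  refine tendsto_of_tendsto_of_tendsto_of_le_of_le' h tendsto_const_nhds ?_ ?_
  · filter_upwards [eventually_gt_atTop 0] with t ht
    linarith [one_sub_density_le_sqrt hd hreg htrans hbip ht]
  · filter_upwards [eventually_ge_atTop 0] with t ht
    exact (density_lt_one ht).le

theorem tendsto_one_sub_density_mul_log (hd : 0 < d) (hreg : G.IsRegularOfDegree d)
    (htrans : IsVertexTransitive G) (hbip : G.IsBipartite) :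
    Tendsto (fun t => (1 - density G t) * Real.log t) atTop (𝓝 0) := by
  have h := (isLittleO_log_rpow_atTop (r := 1 / 2) (by norm_num)).tendsto_div_nhds_zero
  refine tendsto_of_tendsto_of_tendsto_of_le_of_le' tendsto_const_nhds h ?_ ?_
  · filter_upwards [eventually_ge_atTop 1] with t ht
    exact mul_nonneg (by linarith [density_lt_one (G := G) (t := t) (by linarith)])
      (Real.log_nonneg ht)
  · filter_upwards [eventually_ge_atTop 1] with t ht
    have := one_sub_density_le_sqrt hd hreg htrans hbip (t := t) (by linarith)
    rw [← Real.sqrt_eq_rpow, div_eq_inv_mul, ← Real.sqrt_inv]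
    exact mul_le_mul_of_nonneg_right this (Real.log_nonneg ht)

/-- At large activity almost all of the weight lies on the perfect matchings. -/
theorem tendsto_perfect_ratio (hd : 0 < d) (hreg : G.IsRegularOfDegree d)
    (htrans : IsVertexTransitive G) (hbip : G.IsBipartite) :
    Tendsto (fun t => numPerfectMatchings G * t ^ (Fintype.card V / 2) / deletedSum G ∅ t)
      atTop (𝓝 1) := by
  have h : Tendsto (fun t => 1 - (1 - density G t) * Fintype.card V) atTop (𝓝 1) := by
    have := (((tendsto_density_atTop hd hreg htrans hbip).const_sub 1).mul_const
      (Fintype.card V : ℝ)).const_sub 1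
    simpa using this
  refine tendsto_of_tendsto_of_tendsto_of_le_of_le' h tendsto_const_nhds ?_ ?_
  · filter_upwards [eventually_ge_atTop 0] with t ht
    rw [le_div_iff₀ (deletedSum_pos ht)]
    exact le_numPerfectMatchings_mul_pow ht
  · filter_upwards [eventually_ge_atTop 0] with t ht
    rw [div_le_one (deletedSum_pos ht)]
    exact numPerfectMatchings_mul_pow_le ht

theorem numPerfectMatchings_pos (hd : 0 < d) (hreg : G.IsRegularOfDegree d)
    (htrans : IsVertexTransitive G) (hbip : G.IsBipartite) : 0 < numPerfectMatchings G := by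
  rw [Nat.pos_iff_ne_zero]
  intro h0
  have h := tendsto_perfect_ratio hd hreg htrans hbip
  simp only [h0, Nat.cast_zero, zero_mul, zero_div] at h
  exact zero_ne_one (tendsto_nhds_unique tendsto_const_nhds h)

theorem exists_perfect (hd : 0 < d) (hreg : G.IsRegularOfDegree d)
    (htrans : IsVertexTransitive G) (hbip : G.IsBipartite) :
    ∃ S, IsEdgeMatching G S ∧ 2 * S.card = Fintype.card V := by
  classical
  have h := numPerfectMatchings_pos hd hreg htrans hbip
  rw [numPerfectMatchings_eq_card, Finset.card_pos] at h
  obtain ⟨S, hS⟩ := h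
  rw [Finset.mem_filter, mem_matchingsAvoiding_empty] at hS
  exact ⟨S, hS⟩

theorem maxDensity_eq_one (hd : 0 < d) (hreg : G.IsRegularOfDegree d)
    (htrans : IsVertexTransitive G) (hbip : G.IsBipartite) : maxDensity G = 1 := by
  obtain ⟨S, hS, hcard⟩ := exists_perfect hd hreg htrans hbip
  have hub : S.card ∈ upperBounds {k : ℕ | ∃ S, IsEdgeMatching G S ∧ S.card = k} := by
    rintro k ⟨S', hS', rfl⟩
    have := two_mul_card_le hS'
    omega
  have h : matchingNumber G = S.card :=
    le_antisymm (csSup_le ⟨_, S, hS, rfl⟩ hub) (le_csSup ⟨_, hub⟩ ⟨S, hS, rfl⟩)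
  have hV : (Fintype.card V : ℝ) ≠ 0 := by exact_mod_cast Fintype.card_ne_zero
  rw [maxDensity, h, div_eq_one_iff_eq hV]
  exact_mod_cast hcard

theorem tendsto_freeEntropy_atTop (hd : 0 < d) (hreg : G.IsRegularOfDegree d)
    (htrans : IsVertexTransitive G) (hbip : G.IsBipartite) :
    Tendsto (freeEntropy G) atTop
      (𝓝 (Real.log (numPerfectMatchings G) / Fintype.card V)) := by
  have hV : (0 : ℝ) < Fintype.card V := by exact_mod_cast Fintype.card_pos
  have hm : (0 : ℝ) < numPerfectMatchings G := by
    exact_mod_cast numPerfectMatchings_pos hd hreg htrans hbip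
  obtain ⟨S, -, hcard⟩ := exists_perfect hd hreg htrans hbip
  have hn : ((Fintype.card V / 2 : ℕ) : ℝ) = Fintype.card V / 2 := by
    rw [← hcard]; simp
  have h1 := (tendsto_perfect_ratio hd hreg htrans hbip).log one_ne_zero
  rw [Real.log_one] at h1
  have h2 := tendsto_one_sub_density_mul_log hd hreg htrans hbip
  have h3 := ((h1.const_sub (Real.log (numPerfectMatchings G))).div_const
    (Fintype.card V : ℝ)).add (h2.const_mul (1 / 2))
  rw [sub_zero, mul_zero, add_zero] at h3
  refine h3.congr' ?_
  filter_upwards [eventually_gt_atTop 0] with t ht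
  have hZ := deletedSum_pos (G := G) (A := ∅) ht.le
  rw [Real.log_div (by positivity) hZ.ne', Real.log_mul hm.ne' (by positivity), Real.log_pow, hn,
    freeEntropy, eval_matchingGenPoly]
  field_simp
  ring

/-! ### The inverse of the density -/

theorem activity_density (hd : 0 < d) (hreg : G.IsRegularOfDegree d) (ht : 0 ≤ t) :
    activity G (density G t) = t := by
  obtain ⟨u, v, huv⟩ := exists_adj_of_isRegularOfDegree hd hreg
  have hex : ∃ a ∈ Set.Ici (0 : ℝ), density G a = density G t := ⟨t, ht, rfl⟩
  exact (strictMonoOn_density huv).injOn (Function.invFunOn_mem hex) ht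
    (Function.invFunOn_eq hex)

theorem exists_density_eq (hd : 0 < d) (hreg : G.IsRegularOfDegree d)
    (htrans : IsVertexTransitive G) (hbip : G.IsBipartite) {p : ℝ} (hp : p ∈ Set.Ico (0 : ℝ) 1) :
    ∃ t, 0 ≤ t ∧ density G t = p := by
  obtain ⟨T, hT0, hT⟩ := ((eventually_ge_atTop (0 : ℝ)).and
    ((tendsto_density_atTop hd hreg htrans hbip).eventually_const_lt hp.2)).exists
  obtain ⟨t, ht, h⟩ := intermediate_value_Icc hT0
    ((continuousOn_density (G := G)).mono Set.Icc_subset_Ici_self)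
    (show p ∈ Set.Icc _ _ from ⟨by rw [density_zero]; exact hp.1, hT.le⟩)
  exact ⟨t, ht.1, h⟩

theorem tendsto_activity (hd : 0 < d) (hreg : G.IsRegularOfDegree d)
    (htrans : IsVertexTransitive G) (hbip : G.IsBipartite) :
    Tendsto (activity G) (𝓝[<] 1) atTop := by
  rw [tendsto_atTop]
  intro T
  have h0 := density_nonneg (G := G) (le_max_right T 0)
  have h1 := density_lt_one (G := G) (le_max_right T 0)
  filter_upwards [Ioo_mem_nhdsLT h1] with q hq
  obtain ⟨t, ht, rfl⟩ := exists_density_eq hd hreg htrans hbip ⟨h0.trans hq.1.le, hq.2⟩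
  rw [activity_density hd hreg ht]
  obtain ⟨u, v, huv⟩ := exists_adj_of_isRegularOfDegree hd hreg
  exact (le_max_left T 0).trans
    (((strictMonoOn_density huv).lt_iff_lt (le_max_right T 0) ht).1 hq.1).le

theorem matchingEntropy_density (hd : 0 < d) (hreg : G.IsRegularOfDegree d)
    (htrans : IsVertexTransitive G) (hbip : G.IsBipartite) (ht : 0 ≤ t) :
    matchingEntropy G (density G t) = freeEntropy G t := by
  rw [matchingEntropy, maxDensity_eq_one hd hreg htrans hbip, if_pos (density_lt_one ht),
    activity_density hd hreg ht]

theorem tendsto_freeEntropy_activity (hd : 0 < d) (hreg : G.IsRegularOfDegree d)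
    (htrans : IsVertexTransitive G) (hbip : G.IsBipartite) :
    Tendsto (fun q => freeEntropy G (activity G q)) (𝓝[<] 1)
      (𝓝 (Real.log (numPerfectMatchings G) / Fintype.card V)) :=
  (tendsto_freeEntropy_atTop hd hreg htrans hbip).comp (tendsto_activity hd hreg htrans hbip)

theorem matchingEntropy_one (hd : 0 < d) (hreg : G.IsRegularOfDegree d)
    (htrans : IsVertexTransitive G) (hbip : G.IsBipartite) :
    matchingEntropy G 1 = Real.log (numPerfectMatchings G) / Fintype.card V := by
  rw [matchingEntropy, maxDensity_eq_one hd hreg htrans hbip, if_neg (lt_irrefl _), if_pos rfl]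
  exact (tendsto_freeEntropy_activity hd hreg htrans hbip).limUnder_eq

theorem tendsto_matchingEntropy_one (hd : 0 < d) (hreg : G.IsRegularOfDegree d)
    (htrans : IsVertexTransitive G) (hbip : G.IsBipartite) :
    Tendsto (matchingEntropy G) (𝓝[<] 1) (𝓝 (matchingEntropy G 1)) := by
  rw [matchingEntropy_one hd hreg htrans hbip]
  refine (tendsto_freeEntropy_activity hd hreg htrans hbip).congr' ?_
  filter_upwards [self_mem_nhdsWithin] with q hq
  rw [matchingEntropy, maxDensity_eq_one hd hreg htrans hbip, if_pos (Set.mem_Iio.1 hq)]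

end Regular

end Analysis

/-! ### Gurvits's function and the cycle weight -/

section Gurvits

variable {d : ℕ} {x : ℝ}

theorem gurvitsFun_zero : gurvitsFun d 0 = 0 := by simp [gurvitsFun]

theorem gurvitsFun_one (hd : 2 ≤ d) :
    gurvitsFun d 1 = 1 / 2 * Real.log (((d : ℝ) - 1) ^ (d - 1) / (d : ℝ) ^ (d - 2)) := by
  have hd' : (2 : ℝ) ≤ d := by exact_mod_cast hd
  have h1 : 1 - 1 / (d : ℝ) = (d - 1) / d := by field_simp
  have h2 : (0 : ℝ) < d - 1 := by linarith
  rw [gurvitsFun, h1, Real.log_div h2.ne' (by positivity),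
    Real.log_div (pow_ne_zero _ h2.ne') (pow_ne_zero _ (by positivity)), Real.log_pow,
    Real.log_pow, Nat.cast_sub (by omega), Nat.cast_sub (by omega)]
  simp
  ring

theorem one_sub_div_pos (hd : 2 ≤ d) (hx : x ≤ 1) : 0 < 1 - x / (d : ℝ) := by
  have hd' : (2 : ℝ) ≤ d := by exact_mod_cast hd
  rw [sub_pos, div_lt_one (by positivity)]
  linarith

theorem continuousOn_gurvitsFun (hd : 2 ≤ d) : ContinuousOn (gurvitsFun d) (Set.Icc 0 1) := by
  have hd' : (2 : ℝ) ≤ d := by exact_mod_cast hd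
  have h : gurvitsFun d = fun p => 1 / 2 * ((p * Real.log d - p * Real.log p) +
      ((d : ℝ) - p) * Real.log (1 - p / d) - 2 * ((1 - p) * Real.log (1 - p))) := by
    ext p
    rw [gurvitsFun]
    rcases eq_or_ne p 0 with rfl | hp
    · simp
    · rw [Real.log_div (by positivity) hp]; ring
  rw [h]
  have h1 : Continuous fun p : ℝ => p * Real.log p := Real.continuous_mul_log
  have h2 : Continuous fun p : ℝ => (1 - p) * Real.log (1 - p) :=
    h1.comp (continuous_const.sub continuous_id)
  have h3 : ContinuousOn (fun p : ℝ => Real.log (1 - p / d)) (Set.Icc 0 1) :=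
    ContinuousOn.log (by fun_prop) fun p hp => (one_sub_div_pos hd hp.2).ne'
  exact continuousOn_const.mul ((((Continuous.continuousOn (by fun_prop)).sub
    h1.continuousOn).add ((Continuous.continuousOn (by fun_prop)).mul h3)).sub
    (continuousOn_const.mul h2.continuousOn))

/-- The derivative of Gurvits's function is `-1/2` times the logarithm of the activity at which
the infinite `d`-regular tree has density `x`. -/
theorem hasDerivAt_gurvitsFun (hd : 2 ≤ d) (hx0 : 0 < x) (hx1 : x < 1) :
    HasDerivAt (gurvitsFun d)
      (-(1 / 2) * Real.log (x * (1 - x / d) / (d * (1 - x) ^ 2))) x := by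
  have hd' : (2 : ℝ) ≤ d := by exact_mod_cast hd
  have hd0 : (d : ℝ) ≠ 0 := by positivity
  have h1 := one_sub_div_pos hd hx1.le
  have h2 : (0 : ℝ) < 1 - x := by linarith
  have hid := hasDerivAt_id x
  have e1 := hid.mul (((hasDerivAt_const x (d : ℝ)).div hid hx0.ne').log
    (div_pos (by positivity) hx0).ne')
  have e2 := (hid.const_sub (d : ℝ)).mul (((hid.div_const (d : ℝ)).const_sub 1).log h1.ne')
  have e3 := ((hid.const_sub 1).const_mul 2).mul ((hid.const_sub 1).log h2.ne')
  have e := (((e1.add e2).sub e3).const_mul (1 / 2))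
  refine e.congr_deriv ?_
  have h4 : (d : ℝ) - x ≠ 0 := by linarith
  simp only [id]
  have hl : Real.log (x * (1 - x / d) / (d * (1 - x) ^ 2)) =
      Real.log x + Real.log (1 - x / d) - (Real.log d + 2 * Real.log (1 - x)) := by
    rw [Real.log_div (by positivity) (by positivity), Real.log_mul hx0.ne' h1.ne',
      Real.log_mul (by positivity) (by positivity), Real.log_pow]
    norm_num
  simp only [Pi.div_apply, id]
  rw [hl, Real.log_div hd0 hx0.ne']
  have h5 : (1 : ℝ) - x / d = (d - x) / d := by field_simp
  rw [h5] at h1 ⊢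
  field_simp
  ring

theorem continuous_cycleWeight : Continuous (cycleWeight d) := by
  unfold cycleWeight
  fun_prop

theorem cycleWeight_nonneg (hx : 0 ≤ x) : 0 ≤ cycleWeight d x :=
  mul_nonneg (by positivity) (le_min hx (sq_nonneg _))

theorem cycleWeight_le (hx : x ≤ 1) : cycleWeight d x ≤ 1 / (4 * d) :=
  mul_le_of_le_one_right (by positivity) ((min_le_left _ _).trans hx)

/-- Below the activity `1 / d` the first argument of the minimum is the relevant one, above it
the second. -/
theorem cycleWeight_le_of_activity {p t : ℝ} (hd : 0 < d) (ht : 0 < t) (hp0 : 0 ≤ p)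
    (hp1 : p < 1) (h1 : 1 ≤ (1 + d * t) * (1 - p))
    (h2 : d * t * (1 - p) ^ 2 ≤ p * (1 - p / d)) :
    cycleWeight d p ≤ t / (1 + d * t) ^ 2 := by
  have hd' : (0 : ℝ) < d := by exact_mod_cast hd
  have hs : 0 < (d : ℝ) * t := by positivity
  have hw : cycleWeight d p = min p ((1 - p) ^ 2) / (4 * d) := by
    rw [cycleWeight]; ring
  have ht' : t / (1 + d * t) ^ 2 = 4 * (d * t) / (1 + d * t) ^ 2 / (4 * d) := by
    field_simp
  rw [hw, ht']
  refine div_le_div_of_nonneg_right ?_ (by positivity)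
  rw [le_div_iff₀ (by positivity)]
  generalize hsdef : (d : ℝ) * t = s at *
  rcases le_total s 1 with hs1 | hs1
  · have h3 : p ≤ s := by nlinarith
    calc min p ((1 - p) ^ 2) * (1 + s) ^ 2 ≤ p * (1 + s) ^ 2 := by gcongr; exact min_le_left _ _
      _ ≤ s * 2 ^ 2 := by gcongr; linarith
      _ = 4 * s := by ring
  · have h3 : (1 - p) ^ 2 * (1 + s) ≤ 1 := by
      have : 0 ≤ p * (p / d) := by positivity
      nlinarith
    calc min p ((1 - p) ^ 2) * (1 + s) ^ 2 ≤ (1 - p) ^ 2 * (1 + s) ^ 2 := by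
          gcongr; exact min_le_right _ _
      _ = ((1 - p) ^ 2 * (1 + s)) * (1 + s) := by ring
      _ ≤ 1 * (1 + s) := by gcongr
      _ ≤ 4 * s := by linarith

end Gurvits

/-! ### The gap function -/

section Gap

variable [Fintype V] [Nonempty V] {G : SimpleGraph V} [G.LocallyFinite] {d : ℕ} {t : ℝ}

theorem density_pos (hd : 0 < d) (hreg : G.IsRegularOfDegree d) (ht : 0 < t) :
    0 < density G t := by
  obtain ⟨u, v, huv⟩ := exists_adj_of_isRegularOfDegree hd hreg
  rw [← density_zero (G := G)]
  exact strictMonoOn_density huv (Set.mem_Ici.2 le_rfl) (Set.mem_Ici.2 ht.le) ht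

/-- In terms of the activity `t`, the gap has derivative
`p'(t) / 2 * (log t_tree(p(t)) - log t)`, so a pointwise lower bound `φ(p)` for half of the
difference of the logarithms integrates to a lower bound for the growth of the gap. -/
theorem monotoneOn_gap_sub_integral (hd : 2 ≤ d) (hreg : G.IsRegularOfDegree d)
    (htrans : IsVertexTransitive G) (hbip : G.IsBipartite) {φ : ℝ → ℝ} (hφ : Continuous φ)
    (hle : ∀ t, 0 < t → φ (density G t) ≤ 1 / 2 * (Real.log (density G t *
      (1 - density G t / d) / (d * (1 - density G t) ^ 2)) - Real.log t)) :
    MonotoneOn (fun p => gap G d p - ∫ x in (0 : ℝ)..p, φ x) (Set.Icc 0 1) := by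
  have hd0 : 0 < d := by omega
  obtain ⟨u, v, huv⟩ := exists_adj_of_isRegularOfDegree hd0 hreg
  have hΦ : ∀ p, HasDerivAt (fun p => ∫ x in (0 : ℝ)..p, φ x) (φ p) p := fun p =>
    (hφ.integral_hasStrictDerivAt 0 p).hasDerivAt
  have hΦc : Continuous fun p => ∫ x in (0 : ℝ)..p, φ x :=
    continuous_iff_continuousAt.2 fun p => (hΦ p).continuousAt
  have hmaps : Set.MapsTo (density G) (Set.Ici 0) (Set.Icc 0 1) := fun t ht =>
    ⟨density_nonneg ht, (density_lt_one ht).le⟩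
  have hmono : MonotoneOn (fun t => freeEntropy G t - gurvitsFun d (density G t) -
      ∫ x in (0 : ℝ)..density G t, φ x) (Set.Ici 0) := by
    have hderiv : ∀ t, 0 < t → ∃ D, 0 ≤ D ∧ HasDerivAt (fun t => freeEntropy G t -
        gurvitsFun d (density G t) - ∫ x in (0 : ℝ)..density G t, φ x) D t := by
      intro t ht
      obtain ⟨p', hp', hp⟩ := exists_hasDerivAt_density_pos huv ht
      refine ⟨_, ?_, ((hasDerivAt_freeEntropy ht hp).sub
        ((hasDerivAt_gurvitsFun hd (density_pos hd0 hreg ht)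
          (density_lt_one ht.le)).comp t hp)).sub ((hΦ _).comp t hp)⟩
      have := mul_le_mul_of_nonneg_left (hle t ht) hp'.le
      linarith
    refine monotoneOn_of_deriv_nonneg (convex_Ici 0) ?_ ?_ ?_
    · exact (continuousOn_freeEntropy.sub ((continuousOn_gurvitsFun hd).comp continuousOn_density
        hmaps)).sub (hΦc.comp_continuousOn continuousOn_density)
    · intro t ht
      rw [interior_Ici] at ht
      obtain ⟨D, -, hD⟩ := hderiv t ht
      exact hD.differentiableAt.differentiableWithinAt
    · intro t ht
      rw [interior_Ici] at ht
      obtain ⟨D, h0, hD⟩ := hderiv t ht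
      rwa [hD.deriv]
  have hlt : ∀ p ∈ Set.Ico (0 : ℝ) 1, ∀ q ∈ Set.Ico (0 : ℝ) 1, p ≤ q →
      gap G d p - ∫ x in (0 : ℝ)..p, φ x ≤ gap G d q - ∫ x in (0 : ℝ)..q, φ x := by
    intro p hp q hq hpq
    obtain ⟨a, ha, rfl⟩ := exists_density_eq hd0 hreg htrans hbip hp
    obtain ⟨b, hb, rfl⟩ := exists_density_eq hd0 hreg htrans hbip hq
    have := hmono ha hb (((strictMonoOn_density huv).le_iff_le ha hb).1 hpq)
    simpa only [gap, matchingEntropy_density hd0 hreg htrans hbip ha,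
      matchingEntropy_density hd0 hreg htrans hbip hb] using this
  intro p hp q hq hpq
  rcases hq.2.lt_or_eq with hq1 | rfl
  · exact hlt p ⟨hp.1, hpq.trans_lt hq1⟩ q ⟨hq.1, hq1⟩ hpq
  -- The endpoint `1` is reached by passing to the limit.
  rcases hp.2.lt_or_eq with hp1 | rfl
  swap
  · exact le_rfl
  have hgurv : Tendsto (gurvitsFun d) (𝓝[<] 1) (𝓝 (gurvitsFun d 1)) :=
    ((continuousOn_gurvitsFun hd) 1 (by simp)).tendsto.mono_left
      (nhdsWithin_le_of_mem (Icc_mem_nhdsLT zero_lt_one))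
  have hlim : Tendsto (fun q => gap G d q - ∫ x in (0 : ℝ)..q, φ x) (𝓝[<] 1)
      (𝓝 (gap G d 1 - ∫ x in (0 : ℝ)..1, φ x)) :=
    ((tendsto_matchingEntropy_one hd0 hreg htrans hbip).sub hgurv).sub
      ((hΦc.tendsto 1).mono_left nhdsWithin_le_nhds)
  refine ge_of_tendsto hlim ?_
  filter_upwards [Ioo_mem_nhdsLT hp1] with q hq
  exact hlt p ⟨hp.1, hp1⟩ q ⟨hp.1.trans hq.1.le, hq.2⟩ hq.1.le

theorem gap_zero (hd : 0 < d) (hreg : G.IsRegularOfDegree d)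
    (htrans : IsVertexTransitive G) (hbip : G.IsBipartite) : gap G d 0 = 0 := by
  have h := matchingEntropy_density hd hreg htrans hbip le_rfl
  rw [density_zero, freeEntropy_zero] at h
  rw [gap, h, gurvitsFun_zero, sub_zero]

theorem monotoneOn_gap (hd : 2 ≤ d) (hreg : G.IsRegularOfDegree d)
    (htrans : IsVertexTransitive G) (hbip : G.IsBipartite) :
    MonotoneOn (gap G d) (Set.Icc 0 1) := by
  have hd0 : 0 < d := by omega
  have hd' : (0 : ℝ) < d := by exact_mod_cast hd0
  have h := monotoneOn_gap_sub_integral hd hreg htrans hbip (φ := fun _ => 0) continuous_const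
    fun t ht => by
      have hp1 := density_lt_one (G := G) ht.le
      have h1 : 0 < 1 - density G t := by linarith
      have := Real.log_le_log ht (y := density G t * (1 - density G t / d) /
        (d * (1 - density G t) ^ 2)) (by
          rw [le_div_iff₀ (by positivity)]
          have := density_ge_tree hd0 hreg htrans hbip ht
          linarith)
      linarith
  simpa using h

theorem integral_cycleWeight_le_gap (hd : 2 ≤ d) (hreg : G.IsRegularOfDegree d)
    (htrans : IsVertexTransitive G) (hbip : G.IsBipartite) {l : ℕ}
    (hcyc : HasCycleOfLength G l) {p : ℝ} (hp : p ∈ Set.Icc (0 : ℝ) 1) :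
    ∫ x in (0 : ℝ)..p, cycleWeight d x ^ l ≤ gap G d p := by
  have hd0 : 0 < d := by omega
  have hd' : (2 : ℝ) ≤ d := by exact_mod_cast hd
  have hl : 3 ≤ l := by
    obtain ⟨v, c, hc, rfl⟩ := hcyc
    exact hc.three_le_length
  have h := monotoneOn_gap_sub_integral hd hreg htrans hbip
    (φ := fun x => cycleWeight d x ^ l) (continuous_cycleWeight.pow l) fun t ht => by
      have hp0 := density_nonneg (G := G) ht.le
      have hp1 := density_lt_one (G := G) ht.le
      have hcy := density_ge_of_cycle hd0 hreg htrans hbip hcyc ht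
      have hf := cycleWeight_le_of_activity hd0 ht hp0 hp1
        (one_le_mul_one_sub_density hreg htrans ht.le) (density_ge_tree hd0 hreg htrans hbip ht)
      have hf0 := cycleWeight_nonneg (d := d) hp0
      have hf1 := cycleWeight_le (d := d) hp1.le
      set p := density G t
      set f := cycleWeight d p
      have h1 : 0 < 1 - p := by linarith
      have hfl : 0 ≤ f ^ (l - 1) := pow_nonneg hf0 _
      have hf_one : f ≤ 1 := hf1.trans (by
        rw [div_le_one (by positivity)]; linarith)
      have hfl1 : f ^ (l - 1) ≤ 1 := pow_le_one₀ hf0 hf_one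
      -- The ratio of the two activities is at least `1 + y` with `y = f ^ (l - 1) / d`.
      have hy : t * (1 + f ^ (l - 1) / d) ≤ p * (1 - p / d) / (d * (1 - p) ^ 2) := by
        rw [le_div_iff₀ (by positivity)]
        calc t * (1 + f ^ (l - 1) / d) * (d * (1 - p) ^ 2)
            = t * (1 - p) ^ 2 * (d + f ^ (l - 1)) := by field_simp
          _ ≤ t * (1 - p) ^ 2 * (d + (t / (1 + d * t) ^ 2) ^ (l - 1)) := by gcongr
          _ ≤ _ := hcy
      have hy0 : 0 ≤ f ^ (l - 1) / d := by positivity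
      have hy1 : f ^ (l - 1) / d ≤ 1 := by
        rw [div_le_one (by positivity)]; linarith
      have hlog := Real.log_le_log (by positivity) hy
      rw [Real.log_mul ht.ne' (by positivity)] at hlog
      have hlog2 : f ^ (l - 1) / d / 2 ≤ Real.log (1 + f ^ (l - 1) / d) := by
        refine le_trans ?_ (Real.one_sub_inv_le_log_of_pos (by positivity))
        generalize f ^ (l - 1) / d = y at *
        have : 1 - (1 + y)⁻¹ = y / (1 + y) := by field_simp; ring
        rw [this]
        gcongr
        linarith
      have hpow : f ^ l ≤ f ^ (l - 1) / d / 4 := by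
        calc f ^ l = f ^ (l - 1) * f := by rw [← pow_succ, Nat.sub_add_cancel (by omega)]
          _ ≤ f ^ (l - 1) * (1 / (4 * d)) := by gcongr
          _ = _ := by field_simp
      linarith
  have h2 := h (Set.left_mem_Icc.2 zero_le_one) hp hp.1
  simp only [intervalIntegral.integral_same, gap_zero hd0 hreg htrans hbip, sub_zero] at h2
  linarith

/-- The value of the entropy function at `1` counts the perfect matchings, and Gurvits's function
at `1` is half the logarithm of `(d - 1) ^ (d - 1) / d ^ (d - 2)`. -/
theorem pow_le_numPerfectMatchings_of_le_gap_one (hd : 2 ≤ d) (hreg : G.IsRegularOfDegree d)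
    (htrans : IsVertexTransitive G) (hbip : G.IsBipartite) {n : ℕ}
    (hn : Fintype.card V = 2 * n) {I : ℝ} (hI : I ≤ gap G d 1) :
    (((d : ℝ) - 1) ^ (d - 1) / (d : ℝ) ^ (d - 2) * Real.exp (2 * I)) ^ n ≤
      numPerfectMatchings G := by
  have hd0 : 0 < d := by omega
  have hd' : (2 : ℝ) ≤ d := by exact_mod_cast hd
  have hd1 : (0 : ℝ) < d - 1 := by linarith
  have hn0 : (0 : ℝ) < n := by
    have := Fintype.card_pos (α := V)
    exact_mod_cast (by omega : 0 < n)
  have hm : (0 : ℝ) < numPerfectMatchings G := by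
    exact_mod_cast numPerfectMatchings_pos hd0 hreg htrans hbip
  rw [gap, matchingEntropy_one hd0 hreg htrans hbip, gurvitsFun_one hd, hn, le_sub_iff_add_le,
    le_div_iff₀ (by push_cast; positivity)] at hI
  rw [← Real.log_le_log_iff (by positivity) hm, Real.log_pow,
    Real.log_mul (by positivity) (by positivity), Real.log_exp]
  push_cast at hI
  linarith

end Gap

theorem integral_cycleWeight_pow_pos {d : ℕ} (hd : 0 < d) (k : ℕ) :
    0 < ∫ x in (0 : ℝ)..1, cycleWeight d x ^ k := by
  refine intervalIntegral.intervalIntegral_pos_of_pos_on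
    ((continuous_cycleWeight.pow k).intervalIntegrable _ _) (fun x hx => pow_pos ?_ k) zero_lt_one
  have hd' : (0 : ℝ) < d := by exact_mod_cast hd
  have : 0 < 1 - x := by linarith [hx.2]
  exact mul_pos (by positivity) (lt_min hx.1 (by positivity))

theorem integral_cycleWeight_pow_anti {d k l : ℕ} (hd : 0 < d) (hlk : l ≤ k) :
    ∫ x in (0 : ℝ)..1, cycleWeight d x ^ k ≤ ∫ x in (0 : ℝ)..1, cycleWeight d x ^ l := by
  refine intervalIntegral.integral_mono_on zero_le_one
    ((continuous_cycleWeight.pow k).intervalIntegrable _ _)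
    ((continuous_cycleWeight.pow l).intervalIntegrable _ _) fun x hx => ?_
  have hd' : (1 : ℝ) ≤ d := by exact_mod_cast hd
  refine pow_le_pow_of_le_one (cycleWeight_nonneg hx.1) ((cycleWeight_le hx.2).trans ?_) hlk
  rw [div_le_one (by positivity)]
  linarith

end MatchingEntropy

theorem mainTheorem1 (d : ℕ) (hd : 2 ≤ d) :
    (∀ (V : Type u) [Fintype V] [Nonempty V] (G : SimpleGraph V) [G.LocallyFinite],
      G.IsRegularOfDegree d → MatchingEntropy.IsVertexTransitive G → G.IsBipartite →
        MonotoneOn (MatchingEntropy.gap G d) (Set.Icc 0 1) ∧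
        MatchingEntropy.gap G d 0 = 0 ∧
        (∀ p ∈ Set.Icc (0 : ℝ) 1, 0 ≤ MatchingEntropy.gap G d p) ∧
        (∀ l : ℕ, MatchingEntropy.HasCycleOfLength G l → ∀ p ∈ Set.Icc (0 : ℝ) 1,
          (∫ x in (0 : ℝ)..p, MatchingEntropy.cycleWeight d x ^ l)
            ≤ MatchingEntropy.gap G d p)) ∧
    (∀ k : ℕ, ∃ c : ℝ, 0 < c ∧
      ∀ (V : Type u) [Fintype V] [Nonempty V] (G : SimpleGraph V) [G.LocallyFinite],
        G.IsRegularOfDegree d → MatchingEntropy.IsVertexTransitive G → G.IsBipartite →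
        (∃ l : ℕ, l ≤ k ∧ MatchingEntropy.HasCycleOfLength G l) →
        ∀ n : ℕ, Fintype.card V = 2 * n →
          (((d : ℝ) - 1) ^ (d - 1) / (d : ℝ) ^ (d - 2) + c) ^ n
            ≤ (MatchingEntropy.numPerfectMatchings G : ℝ)) := by
  have hd0 : 0 < d := by omega
  have hd' : (2 : ℝ) ≤ d := by exact_mod_cast hd
  refine ⟨fun V _ _ G _ hreg htrans hbip => ?_, fun k => ?_⟩
  · have hmono := MatchingEntropy.monotoneOn_gap hd hreg htrans hbip
    have hzero := MatchingEntropy.gap_zero hd0 hreg htrans hbip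
    refine ⟨hmono, hzero, fun p hp => ?_, fun l hcyc p hp =>
      MatchingEntropy.integral_cycleWeight_le_gap hd hreg htrans hbip hcyc hp⟩
    rw [← hzero]
    exact hmono (Set.left_mem_Icc.2 zero_le_one) hp hp.1
  -- Every cycle of length at most `k` is worth at least `I`, since `0 ≤ f ≤ 1`.
  · set I := ∫ x in (0 : ℝ)..1, MatchingEntropy.cycleWeight d x ^ k with hI
    have hIpos : 0 < I := MatchingEntropy.integral_cycleWeight_pow_pos hd0 k
    have hd1 : (0 : ℝ) < d - 1 := by linarith
    have hbase : (0 : ℝ) < ((d : ℝ) - 1) ^ (d - 1) / (d : ℝ) ^ (d - 2) := by positivity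
    refine ⟨((d : ℝ) - 1) ^ (d - 1) / (d : ℝ) ^ (d - 2) * (Real.exp (2 * I) - 1),
      mul_pos hbase (sub_pos.2 (Real.one_lt_exp_iff.2 (by positivity))), ?_⟩
    rintro V _ _ G _ hreg htrans hbip ⟨l, hlk, hcyc⟩ n hn
    rw [mul_sub, mul_one, add_sub_cancel]
    refine MatchingEntropy.pow_le_numPerfectMatchings_of_le_gap_one hd hreg htrans hbip hn ?_
    exact (MatchingEntropy.integral_cycleWeight_pow_anti hd0 hlk).trans
      (MatchingEntropy.integral_cycleWeight_le_gap hd hreg htrans hbip hcyc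
        (Set.right_mem_Icc.2 zero_le_one))
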